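/- Let $s,\tilde s\in\{0,1\}$, $\epsilon=1-2s$, $\tilde\epsilon=1-2\tilde s$, $c\in\mathbb R\setminus\{0\}$, and let $\mathbb Q_s^4(c)\subset\mathbb R^5_{s+\epsilon_0}$ be the pseudo-Riemannian space form of dimension $4$, index $s$ and constant curvature $c$, realized as the hyperquadric $\langle p,p\rangle=1/c$ (one sheet of it if $s=0$ and $c<0$), where $\epsilon_0=0$ if $c>0$ and $\epsilon_0=1$ if $c<0$. A hypersurface $f\colon M^3\to\mathbb Q_s^4(c)$ is a smooth immersion whose induced metric is Riemannian. Let $N$ be a smooth unit normal vector field of $f$ in $\mathbb Q^4_s(c)$ (so $\langle N,N\rangle=\epsilon$) and $A$ its shape operator, $f_*AX=-N_*X$. The hypersurface $f$ is holonomic if $M^3$ carries global orthogonal coordinates $(u_1,u_2,u_3)$ such that the coordinate vector fields $\partial_j$ are everywhere eigenvectors of $A$; its associated pair $(v,V)$ is then defined by $v_j=\|\partial_j\|$ and $A\partial_j=v_j^{-1}V_j\partial_j$. Put $\hat\epsilon=\epsilon\tilde\epsilon$ and $C=\tilde\epsilon c$, and let $(\delta_1,\delta_2,\delta_3)=(-1,-1,-1)$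 if $\hat\epsilon=-1$ and $C<0$, and $(\delta_1,\delta_2,\delta_3)=(1,-1,1)$ otherwise. Consider the condition $$\sum_{i=1}^3\delta_iv_i^2=\hat\epsilon,\qquad \sum_{i=1}^3\delta_iv_iV_i=0,\qquad \sum_{i=1}^3\delta_iV_i^2=C. \tag{$*$}$$ Let $f\colon M^3\to\mathbb Q_s^4(c)$ be a holonomic hypersurface whose associated pair satisfies $(*)$. For $t\in\mathbb R$ let $$f_t=\varphi(t)\,f+\frac{\psi(t)}{\sqrt{|c|}}\,N,\qquad (\varphi(t),\psi(t))=\begin{cases}(\cos(\sqrt{|c|}\,t),\sin(\sqrt{|c|}\,t))&\text{if }\epsilon c>0,\\(\cosh(\sqrt{|c|}\,t),\sinh(\sqrt{|c|}\,t))&\text{if }\epsilon c<0,\end{cases}$$ be the parallel map, and suppose that $f_t$ is an immersion. Then $f_t$ is a hypersurface $M^3\to\mathbb Q_s^4(c)$ which is holonomic (with respect to the same coordinates) and whose associated pair, for some unit normal vector field of $f_t$, also satisfies $(*)$, with the same $\hat\epsilon$, $C$ and $\delta_i$. Moreover, every simply connected open subset $W\subset M^3$ (in particular $M^3$ itself,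 if it is simply connected), with the metric induced by $f_t$, admits an isometric immersion into the flat space $\mathbb R^4_{\tilde s}$ of index $\tilde s$. -/

import Mathlib

open scoped Manifold ContDiff

noncomputable section

namespace HolonomicHypersurface

/-- The sign `1 - 2 s`, for an index `s ∈ {0, 1}`. -/
def indexSign (s : ℕ) : ℝ := 1 - 2 * (s : ℝ)

/-- The standard inner product of index `k` on `ℝⁿ`: the first `k` coordinates are
time-like, the others are space-like. -/
def pseudoInner {n : ℕ} (k : ℕ) (x y : Fin n → ℝ) : ℝ :=
  ∑ i : Fin n, (if (i : ℕ) < k then -1 else 1) * (x i * y i)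

/-- The index `s + ε₀` of the pseudo-Euclidean space `ℝ⁵` that contains the space form of index
`s` and curvature `c`, with `ε₀ = 0` for `c > 0` and `ε₀ = 1` for `c < 0`. -/
def ambientIndex (s : ℕ) (c : ℝ) : ℕ := if c < 0 then s + 1 else s

/-- The inner product of the pseudo-Euclidean space `ℝ⁵` that contains the space form of index
`s` and curvature `c`. -/
def ambientInner (s : ℕ) (c : ℝ) (x y : Fin 5 → ℝ) : ℝ := pseudoInner (ambientIndex s c) x y

/-- The space form of dimension four, index `s` and constant curvature `c ≠ 0`, as the hyperquadric
`⟨p, p⟩ = 1 / c`; for hyperbolic space (`s = 0`, `c < 0`) it is the sheet on which the time-like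
coordinate is positive. -/
def spaceForm (s : ℕ) (c : ℝ) : Set (Fin 5 → ℝ) :=
  {p | ambientInner s c p p = 1 / c ∧ (s = 0 → c < 0 → 0 < p 0)}

variable {M : Type*} [TopologicalSpace M] [ChartedSpace (EuclideanSpace ℝ (Fin 3)) M]

/-- The differential at `x` of a map from the manifold `M` into `ℝⁿ`. -/
def dmap {n : ℕ} (f : M → (Fin n → ℝ)) (x : M) : TangentSpace (𝓡 3) x →L[ℝ] (Fin n → ℝ) :=
  mfderiv (𝓡 3) 𝓘(ℝ, Fin n → ℝ) f x

/-- `f : M³ → ℚ⁴ₛ(c)` is a hypersurface: a smooth map whose induced metric is Riemannian.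
The manifold `M` carries that induced metric. -/
structure IsHypersurface (s : ℕ) (c : ℝ) (f : M → (Fin 5 → ℝ)) : Prop where
  smooth : ContMDiff (𝓡 3) 𝓘(ℝ, Fin 5 → ℝ) ∞ f
  mem_spaceForm : ∀ x, f x ∈ spaceForm s c
  spacelike : ∀ (x : M) (X : TangentSpace (𝓡 3) x), X ≠ 0 →
    0 < ambientInner s c (dmap f x X) (dmap f x X)

/-- `N` is a smooth unit normal vector field of `f` in the space form: it is tangent to the space
form, orthogonal to `f`, and `⟨N, N⟩ = ε`, which is `1` if `s = 0` and `-1` if `s = 1`. -/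
structure IsUnitNormal (s : ℕ) (c : ℝ) (f N : M → (Fin 5 → ℝ)) : Prop where
  smooth : ContMDiff (𝓡 3) 𝓘(ℝ, Fin 5 → ℝ) ∞ N
  tangent : ∀ x, ambientInner s c (N x) (f x) = 0
  normal : ∀ (x : M) (X : TangentSpace (𝓡 3) x), ambientInner s c (N x) (dmap f x X) = 0
  unit : ∀ x, ambientInner s c (N x) (N x) = indexSign s

/-- `A` is the shape operator of `f` with respect to the unit normal field `N`: the Weingarten
formula `f_* (A X) = -N_* X`. For an immersion `f` there is at most one such `A`. (The
derivative of `N` in `ℝ⁵` has no component along the position vector, since `⟨N, f⟩ = 0` and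
`⟨N, f_* X⟩ = 0`; it is therefore the covariant derivative of `N` in the space form.) -/
def IsShapeOperator (f N : M → (Fin 5 → ℝ))
    (A : ∀ x : M, TangentSpace (𝓡 3) x →ₗ[ℝ] TangentSpace (𝓡 3) x) : Prop :=
  ∀ (x : M) (X : TangentSpace (𝓡 3) x), dmap f x (A x X) = -dmap N x X

/-- `u` is a system of global (smooth) coordinates on `M`: a diffeomorphism of `M` onto an open
subset of `ℝ³`. -/
def IsGlobalCoord (u : OpenPartialHomeomorph M (EuclideanSpace ℝ (Fin 3))) : Prop :=
  u.source = Set.univ ∧ u ∈ IsManifold.maximalAtlas (𝓡 3) ∞ M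

/-- The coordinate vector field `∂_j = ∂ / ∂u_j`. -/
def coordField (u : OpenPartialHomeomorph M (EuclideanSpace ℝ (Fin 3))) (j : Fin 3) (x : M) :
    TangentSpace (𝓡 3) x :=
  (mfderiv (𝓡 3) (𝓡 3) u x).inverse
    (EuclideanSpace.single j (1 : ℝ) : EuclideanSpace ℝ (Fin 3))

/-- The hypersurface `f`, with unit normal field `N`, is holonomic with respect to the global
coordinates `u`, and `(v, V)` is its associated pair: the coordinate vector fields are pairwise
orthogonal, `v_j = ‖∂_j‖`, and `A ∂_j = v_j⁻¹ V_j ∂_j` for the shape operator `A`. -/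
structure IsHolonomicWithPair (s : ℕ) (c : ℝ) (f N : M → (Fin 5 → ℝ))
    (u : OpenPartialHomeomorph M (EuclideanSpace ℝ (Fin 3))) (v V : Fin 3 → M → ℝ) : Prop where
  coord : IsGlobalCoord u
  orthogonal : ∀ (i j : Fin 3), i ≠ j → ∀ x : M,
    ambientInner s c (dmap f x (coordField u i x)) (dmap f x (coordField u j x)) = 0
  norm : ∀ (j : Fin 3) (x : M), v j x =
    Real.sqrt (ambientInner s c (dmap f x (coordField u j x)) (dmap f x (coordField u j x)))
  principal : ∃ A : ∀ x : M, TangentSpace (𝓡 3) x →ₗ[ℝ] TangentSpace (𝓡 3) x,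
    IsShapeOperator f N A ∧
    ∀ (j : Fin 3) (x : M), A x (coordField u j x) = ((v j x)⁻¹ * V j x) • coordField u j x

/-- The signs `(δ₁, δ₂, δ₃)`: `(-1, -1, -1)` if `ε̂ = -1` and `C < 0`, and `(1, -1, 1)` in the
other cases. -/
def deltaSign (e C : ℝ) : Fin 3 → ℝ :=
  if e = -1 ∧ C < 0 then ![-1, -1, -1] else ![1, -1, 1]

/-- The algebraic conditions `∑ δᵢ vᵢ² = ε̂`, `∑ δᵢ vᵢ Vᵢ = 0`, `∑ δᵢ Vᵢ² = C` on the pair `(v, V)`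
of a hypersurface of the space form of index `s` and curvature `c`, for the second
space form of index `s'` and curvature `c'`. Here `ε̂ = ε ε̃` and `C = ε̃ (c - c')`. -/
def PairCondition (s s' : ℕ) (c c' : ℝ) (v V : Fin 3 → M → ℝ) : Prop :=
  let e : ℝ := indexSign s * indexSign s'
  let C : ℝ := indexSign s' * (c - c')
  ∀ x : M,
    ∑ i, deltaSign e C i * v i x ^ 2 = e ∧
    ∑ i, deltaSign e C i * (v i x * V i x) = 0 ∧
    ∑ i, deltaSign e C i * V i x ^ 2 = C

/-- The parallel map `f_t = φ(t) f + (ψ(t) / √|c|) N` at (signed) distance `t`, with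
`(φ, ψ) = (cos (√|c| t), sin (√|c| t))` if `ε c / |c| = 1` and
`(φ, ψ) = (cosh (√|c| t), sinh (√|c| t))` if `ε c / |c| = -1`. -/
def parallelMap (s : ℕ) (c : ℝ) (f N : M → (Fin 5 → ℝ)) (t : ℝ) (x : M) : Fin 5 → ℝ :=
  if 0 < indexSign s * c then
    Real.cos (√|c| * t) • f x + (Real.sin (√|c| * t) / √|c|) • N x
  else
    Real.cosh (√|c| * t) • f x + (Real.sinh (√|c| * t) / √|c|) • N x

/-- `g` is, on the open set `W`, an isometric immersion into the pseudo-Euclidean space of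
dimension four and index `s'`, for the metric that `f` induces from the space form of index
`s` and curvature `c`. -/
def IsIsometricImmersionOn (s s' : ℕ) (c : ℝ) (f : M → (Fin 5 → ℝ)) (g : M → (Fin 4 → ℝ))
    (W : Set M) : Prop :=
  ContMDiffOn (𝓡 3) 𝓘(ℝ, Fin 4 → ℝ) ∞ g W ∧
  ∀ x ∈ W, ∀ X Y : TangentSpace (𝓡 3) x,
    pseudoInner s' (dmap g x X) (dmap g x Y) = ambientInner s c (dmap f x X) (dmap f x Y)

end HolonomicHypersurface

end

/-! Everything rests on one mechanism. In principal coordinates, put `h_ij = v_i⁻¹ ∂_i v_j`. A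
holonomic hypersurface of the space form is governed by `∂_i v_j = h_ij v_i`
(`PrincipalFrame.pd_v`), `∂_i V_j = h_ij V_i` (`PrincipalFrame.codazzi`), `∂_k h_ji = h_jk h_ki`
(`PrincipalFrame.darboux`) and a Gauss equation with curvature term `ε V_i V_j + c v_i v_j`
(`PrincipalFrame.gauss`). If the pair satisfies the algebraic conditions, then `v`, `V` and their
cross product `w` (`crossPair`) form an orthogonal frame for `diag δ`. Completeness of that frame
reads `w_i w_j = C v_i v_j + ε̂ V_i V_j` off the diagonal (`crossPair_mul_crossPair`), so `ε̃ w_i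
w_j` is exactly the curvature term above. Moreover `w` satisfies the same Codazzi equation as `V`
(`pd_crossPair`). Hence `(v, w)` solves the Gauss-Codazzi system of flat space.

The converse direction of surface theory, `exists_flat_immersion`, integrates the frame equations.
Over a simply connected domain this needs a parallel section of a flat connection
(`exists_parallel`): radial solutions of an ODE give local sections, and a covering-space argument
glues them.

For the parallel map, `f` and `N` are rotated (circularly or hyperbolically) in the plane that they
span. This changes `(v_j, V_j)`, up to a common sign for each `j`, by a linear map that preserves
the quadratic form behind the algebraic conditions (`pairCondition_combination`). So `f_t` is again
a hypersurface of the same kind, and the immersion theorem `exists_isometric_immersion` applies to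
it verbatim. -/

noncomputable section

namespace HolonomicHypersurface

/-! ### Radial integration of a connection form with values in a Banach algebra. -/

section FlatConnection

open Set Metric

variable {E : Type*} [NormedAddCommGroup E] [NormedSpace ℝ E]
  {𝔸 : Type*} [NormedRing 𝔸] [NormedAlgebra ℝ 𝔸]

/-- A curve that starts at zero and satisfies `‖R'‖ ≤ ‖R‖ + ε` has norm at most `2 ε` on `[0, 1]`. -/
theorem norm_le_of_norm_deriv_le {F : Type*} [NormedAddCommGroup F] [NormedSpace ℝ F]
    {R R' : ℝ → F} {ε : ℝ} (hε : 0 ≤ ε)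
    (hR : ∀ t ∈ Icc (0 : ℝ) 1, HasDerivWithinAt R (R' t) (Icc 0 1) t) (h0 : R 0 = 0)
    (hb : ∀ t ∈ Icc (0 : ℝ) 1, ‖R' t‖ ≤ ‖R t‖ + ε) :
    ∀ t ∈ Icc (0 : ℝ) 1, ‖R t‖ ≤ 2 * ε := by
  intro t ht
  have h := norm_le_gronwallBound_of_norm_deriv_right_le (f := R) (f' := R') (δ := 0) (K := 1)
    (ε := ε) (a := 0) (b := 1) (fun t ht => (hR t ht).continuousWithinAt)
    (fun t ht => ((hR t (Ico_subset_Icc_self ht)).mono_of_mem_nhdsWithin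
      (Icc_mem_nhdsGE_of_mem ht))) (by simp [h0])
    (fun t ht => by simpa using hb t (Ico_subset_Icc_self ht)) t ht
  refine h.trans ?_
  rw [gronwallBound_of_K_ne_0 one_ne_zero]
  -- Gronwall with rate 1 gives `ε (e^t - 1)`; the factor 2 is a crude bound for `e - 1`.
  have h1 : Real.exp t ≤ Real.exp 1 := Real.exp_le_exp.2 ht.2
  have h2 := Real.exp_one_lt_d9
  have : Real.exp t - 1 ≤ 2 := by linarith
  simp only [sub_zero, one_mul, zero_mul, zero_add, div_one]
  nlinarith

/-- Along each ray from `x₀`, the radial linear equation has a solution that starts at `1`. -/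
theorem exists_radial_solution [CompleteSpace 𝔸] [NormOneClass 𝔸] {Θ : E → E →L[ℝ] 𝔸}
    {x₀ : E} {r K : ℝ} (hcont : ContinuousOn Θ (ball x₀ r)) (hK : ∀ y ∈ ball x₀ r, ‖Θ y‖ ≤ K)
    (hKr : K * r ≤ 1 / 4) {x : E} (hx : x ∈ ball x₀ r) :
    ∃ Q : ℝ → 𝔸, Q 0 = 1 ∧ (∀ t ∈ Icc (0 : ℝ) 1,
      HasDerivWithinAt Q (Θ (x₀ + t • (x - x₀)) (x - x₀) * Q t) (Icc 0 1) t) ∧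
      ∀ t ∈ Icc (0 : ℝ) 1, ‖Q t - 1‖ ≤ 1 / 2 := by
  have hr : 0 < r := pos_of_mem_ball hx
  have hxr : ‖x - x₀‖ ≤ r := by rw [← dist_eq_norm]; exact (mem_ball.1 hx).le
  have hmem : ∀ t ∈ Icc (0 : ℝ) 1, x₀ + t • (x - x₀) ∈ ball x₀ r := fun t ht => by
    have := (convex_ball x₀ r).add_smul_sub_mem (mem_ball_self hr) hx ht
    exact this
  have hA : ∀ t ∈ Icc (0 : ℝ) 1, ‖Θ (x₀ + t • (x - x₀)) (x - x₀)‖ ≤ 1 / 4 := fun t ht => by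
    refine (ContinuousLinearMap.le_opNorm _ _).trans (le_trans ?_ hKr)
    exact mul_le_mul (hK _ (hmem t ht)) hxr (norm_nonneg _)
      ((norm_nonneg _).trans (hK _ (hmem t ht)))
  -- The solution is sought in the closed ball of radius 1/2 about 1. There `‖q‖ ≤ 3/2`, so the
  -- speed is at most 3/8, below the allowed 1/2, and unit time does not suffice to leave the ball.
  have hpl : IsPicardLindelof (fun t (q : 𝔸) => Θ (x₀ + t • (x - x₀)) (x - x₀) * q)
      (tmin := 0) (tmax := 1) ⟨0, by simp⟩ (1 : 𝔸) (1 / 2) 0 (1 / 2) (1 / 4) := by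
    refine ⟨fun t ht => ?_, fun q _ => ?_, fun t ht q hq => ?_, ?_⟩
    · refine LipschitzOnWith.of_dist_le_mul fun p _ q _ => ?_
      rw [dist_eq_norm, dist_eq_norm, ← mul_sub]
      refine (norm_mul_le _ _).trans ?_
      gcongr
      simpa using hA t ht
    · refine ContinuousOn.mul (ContinuousOn.clm_apply ?_ continuousOn_const) continuousOn_const
      exact hcont.comp (by fun_prop) hmem
    · have hq' : ‖q‖ ≤ 3 / 2 := by
        have h1 : ‖q - 1‖ ≤ 1 / 2 := by
          rw [← dist_eq_norm]; simpa using mem_closedBall.1 hq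
        calc ‖q‖ = ‖(q - 1) + 1‖ := by simp
          _ ≤ ‖q - 1‖ + ‖(1 : 𝔸)‖ := norm_add_le _ _
          _ ≤ 3 / 2 := by rw [norm_one]; linarith
      refine (norm_mul_le _ _).trans ?_
      have := mul_le_mul (hA t ht) hq' (norm_nonneg _) (by norm_num)
      refine this.trans ?_
      norm_num
    · norm_num
  obtain ⟨Q, hQ0, hQ⟩ := hpl.exists_eq_forall_mem_Icc_hasDerivWithinAt₀
  refine ⟨Q, hQ0, hQ, ?_⟩
  have := norm_le_of_norm_deriv_le (R := fun t => Q t - 1) (ε := 1 / 4) (by norm_num)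
    (fun t ht => (hQ t ht).sub_const 1) (by simpa using sub_eq_zero.2 hQ0) fun t ht => by
      refine (norm_mul_le _ _).trans ?_
      have h1 : ‖Q t‖ ≤ ‖Q t - 1‖ + 1 := by
        calc ‖Q t‖ = ‖(Q t - 1) + 1‖ := by simp
          _ ≤ _ := (norm_add_le _ _).trans (by rw [norm_one])
      nlinarith [hA t ht, norm_nonneg (Q t), norm_nonneg (Q t - 1)]
  intro t ht
  refine (this t ht).trans (by norm_num)

end FlatConnection

/-! ### Local parallel sections of a flat connection. -/

section FlatConnectionLocal

open Set Metric

variable {E : Type*} [NormedAddCommGroup E] [NormedSpace ℝ E]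
  {𝔸 : Type*} [NormedRing 𝔸] [NormedAlgebra ℝ 𝔸]

/-- The endpoints of the radial solutions of a flat connection form a parallel section. -/
theorem norm_radial_solution_sub_le {Θ : E → E →L[ℝ] 𝔸}
    {Θ' : E → E →L[ℝ] E →L[ℝ] 𝔸} {x₀ : E} {r K L : ℝ} (hL0 : 0 ≤ L)
    (hderiv : ∀ y ∈ ball x₀ r, HasFDerivAt Θ (Θ' y) y)
    (hK : ∀ y ∈ ball x₀ r, ‖Θ y‖ ≤ K)
    (hKr : K * r ≤ 1 / 4) (hr1 : r ≤ 1)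
    (hL : ∀ y ∈ ball x₀ r, ∀ z ∈ ball x₀ r, ‖Θ z - Θ y‖ ≤ L * ‖z - y‖)
    (hL' : ∀ y ∈ ball x₀ r, ∀ z ∈ ball x₀ r, ‖Θ' z - Θ' y‖ ≤ L * ‖z - y‖)
    (hM : ∀ y ∈ ball x₀ r, ‖Θ' y‖ ≤ L)
    (hflat : ∀ y ∈ ball x₀ r, ∀ a b,
      Θ' y a b + Θ y b * Θ y a = Θ' y b a + Θ y a * Θ y b)
    {x z : E} (hx : x ∈ ball x₀ r) (hz : z ∈ ball x₀ r) {p q : ℝ → 𝔸}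
    (hp0 : p 0 = 1) (hq0 : q 0 = 1)
    (hp : ∀ t ∈ Icc (0 : ℝ) 1,
      HasDerivWithinAt p (Θ (x₀ + t • (x - x₀)) (x - x₀) * p t) (Icc 0 1) t)
    (hq : ∀ t ∈ Icc (0 : ℝ) 1,
      HasDerivWithinAt q (Θ (x₀ + t • (z - x₀)) (z - x₀) * q t) (Icc 0 1) t)
    (hqb : ∀ t ∈ Icc (0 : ℝ) 1, ‖q t‖ ≤ 2) :
    ‖q 1 - p 1 - Θ x (z - x) * p 1‖ ≤ (8 * L + 8 * (L + K) * (L + K)) * ‖z - x‖ ^ 2 := by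
  have hr : 0 < r := pos_of_mem_ball hx
  have hK0 : 0 ≤ K := (norm_nonneg _).trans (hK _ hx)
  have hxr : ‖x - x₀‖ ≤ r := by rw [← dist_eq_norm]; exact (mem_ball.1 hx).le
  have hzr : ‖z - x₀‖ ≤ r := by rw [← dist_eq_norm]; exact (mem_ball.1 hz).le
  have hmem : ∀ w ∈ ball x₀ r, ∀ t ∈ Icc (0 : ℝ) 1, x₀ + t • (w - x₀) ∈ ball x₀ r :=
    fun w hw t ht => (convex_ball x₀ r).add_smul_sub_mem (mem_ball_self hr) hw ht
  set h := z - x with hh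
  have hzx : z - x₀ = (x - x₀) + h := by rw [hh]; abel
  have hsub : ∀ t : ℝ, x₀ + t • (z - x₀) - (x₀ + t • (x - x₀)) = t • h := fun t => by
    rw [hh]; module
  have htn : ∀ t ∈ Icc (0 : ℝ) 1, ‖t • h‖ ≤ ‖h‖ := fun t ht => by
    rw [norm_smul, Real.norm_of_nonneg ht.1]
    exact mul_le_of_le_one_left (norm_nonneg _) ht.2
  have hA : ∀ t ∈ Icc (0 : ℝ) 1, ‖Θ (x₀ + t • (x - x₀)) (x - x₀)‖ ≤ 1 := fun t ht => by
    refine (ContinuousLinearMap.le_opNorm _ _).trans (le_trans ?_ (hKr.trans (by norm_num)))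
    exact mul_le_mul (hK _ (hmem x hx t ht)) hxr (norm_nonneg _) hK0
  have hΔ : ∀ t ∈ Icc (0 : ℝ) 1,
      ‖Θ (x₀ + t • (z - x₀)) - Θ (x₀ + t • (x - x₀))‖ ≤ L * ‖h‖ := fun t ht => by
    refine (hL _ (hmem x hx t ht) _ (hmem z hz t ht)).trans ?_
    rw [hsub]
    exact mul_le_mul_of_nonneg_left (htn t ht) hL0
  -- First order estimate: neighbouring radial solutions differ by `O(‖h‖)`.
  have hS : ∀ t ∈ Icc (0 : ℝ) 1, ‖q t - p t‖ ≤ 2 * (2 * (L + K) * ‖h‖) := by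
    refine norm_le_of_norm_deriv_le (by positivity) (fun t ht => (hq t ht).sub (hp t ht))
      (by simp [hp0, hq0]) fun t ht => ?_
    have e : Θ (x₀ + t • (z - x₀)) (z - x₀) * q t - Θ (x₀ + t • (x - x₀)) (x - x₀) * p t
        = Θ (x₀ + t • (x - x₀)) (x - x₀) * (q t - p t)
          + ((Θ (x₀ + t • (z - x₀)) - Θ (x₀ + t • (x - x₀))) (z - x₀)
            + Θ (x₀ + t • (x - x₀)) h) * q t := by
      have : Θ (x₀ + t • (x - x₀)) (z - x₀)
          = Θ (x₀ + t • (x - x₀)) (x - x₀) + Θ (x₀ + t • (x - x₀)) h := by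
        rw [← map_add, ← hzx]
      rw [sub_apply, this]
      noncomm_ring
    rw [e]
    refine (norm_add_le _ _).trans (add_le_add ?_ ?_)
    · refine (norm_mul_le _ _).trans ?_
      exact mul_le_of_le_one_left (norm_nonneg _) (hA t ht)
    · refine (norm_mul_le _ _).trans ?_
      have h1 : ‖(Θ (x₀ + t • (z - x₀)) - Θ (x₀ + t • (x - x₀))) (z - x₀)‖ ≤ L * ‖h‖ * 1 :=
        (ContinuousLinearMap.le_opNorm _ _).trans
          (mul_le_mul (hΔ t ht) (hzr.trans hr1) (norm_nonneg _) (by positivity))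
      have h2 : ‖Θ (x₀ + t • (x - x₀)) h‖ ≤ K * ‖h‖ :=
        (ContinuousLinearMap.le_opNorm _ _).trans
          (mul_le_mul_of_nonneg_right (hK _ (hmem x hx t ht)) (norm_nonneg _))
      have h3 := (norm_add_le _ _).trans (add_le_add h1 h2)
      calc _ ≤ (L * ‖h‖ * 1 + K * ‖h‖) * 2 :=
            mul_le_mul h3 (hqb t ht) (norm_nonneg _) (by positivity)
        _ = _ := by ring
  have htaylor : ∀ t ∈ Icc (0 : ℝ) 1,
      ‖Θ (x₀ + t • (z - x₀)) - Θ (x₀ + t • (x - x₀)) - Θ' (x₀ + t • (x - x₀)) (t • h)‖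
        ≤ L * ‖h‖ * ‖h‖ := fun t ht => by
    have := (convex_segment (𝕜 := ℝ) (x₀ + t • (x - x₀)) (x₀ + t • (z - x₀))).norm_image_sub_le_of_norm_hasFDerivWithin_le'
      (f := Θ) (f' := Θ') (φ := Θ' (x₀ + t • (x - x₀))) (C := L * ‖h‖)
      (fun w hw => (hderiv w ((convex_ball x₀ r).segment_subset (hmem x hx t ht) (hmem z hz t ht) hw)).hasFDerivWithinAt)
      (fun w hw => ?_) (left_mem_segment ℝ _ _) (right_mem_segment ℝ _ _)
    · rw [hsub] at this
      exact this.trans (mul_le_mul_of_nonneg_left (htn t ht) (by positivity))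
    · refine (hL' _ (hmem x hx t ht) _
        ((convex_ball x₀ r).segment_subset (hmem x hx t ht) (hmem z hz t ht) hw)).trans ?_
      refine mul_le_mul_of_nonneg_left ?_ hL0
      have hw' := norm_sub_le_of_mem_segment hw
      rw [hsub] at hw'
      exact hw'.trans (htn t ht)
  -- A parallel section would change by about `t Θ(h) p` between the points at time `t` on the two
  -- rays. `R` is the error of this prediction; `R 1` is the quantity to be estimated.
  set R : ℝ → 𝔸 := fun t => q t - p t - t • Θ (x₀ + t • (x - x₀)) h * p t with hRdef
  have hγ : ∀ t ∈ Icc (0 : ℝ) 1, HasDerivWithinAt (fun t : ℝ => Θ (x₀ + t • (x - x₀)) h)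
      (Θ' (x₀ + t • (x - x₀)) (x - x₀) h) (Icc 0 1) t := fun t ht => by
    have h1 : HasDerivWithinAt (fun t : ℝ => x₀ + t • (x - x₀)) (x - x₀) (Icc 0 1) t := by
      simpa using! ((hasDerivWithinAt_id t (Icc (0 : ℝ) 1)).smul_const (x - x₀)).const_add x₀
    have h2 := (hderiv _ (hmem x hx t ht)).comp_hasDerivWithinAt t h1
    simpa using! h2.clm_apply (hasDerivWithinAt_const t _ h)
  have hR : ∀ t ∈ Icc (0 : ℝ) 1, ‖R t‖ ≤ 2 * ((4 * L + 4 * (L + K) * (L + K)) * ‖h‖ ^ 2) := by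
    refine norm_le_of_norm_deriv_le (by positivity)
      (fun t ht => ((hq t ht).sub (hp t ht)).sub
        (((hasDerivWithinAt_id t _).smul (hγ t ht)).mul (hp t ht)))
      (by simp [hRdef, hp0, hq0]) fun t ht => ?_
    have hf := hflat _ (hmem x hx t ht) (x - x₀) h
    set y := x₀ + t • (x - x₀) with hy
    set w := x₀ + t • (z - x₀) with hw
    -- Flatness replaces `Θ' (x - x₀) h` by `Θ' h (x - x₀)` plus a commutator. The commutator
    -- restores `Θ(x - x₀) R`, and the rest is the Taylor remainder of `Θ` and products of two first
    -- order differences, hence `O(‖h‖²)`.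
    have e : Θ w (z - x₀) * q t - Θ y (x - x₀) * p t
          - ((id t • Θ' y (x - x₀) h + (1 : ℝ) • Θ y h) * p t
            + (id t • Θ y h) * (Θ y (x - x₀) * p t))
        = Θ y (x - x₀) * R t
          + (((Θ w - Θ y - Θ' y (t • h)) (x - x₀) + (Θ w - Θ y) h) * q t
            + (Θ y h + t • Θ' y h (x - x₀)) * (q t - p t)) := by
      have hf' : Θ' y (x - x₀) h = Θ' y h (x - x₀) + Θ y (x - x₀) * Θ y h
          - Θ y h * Θ y (x - x₀) := by rw [← hf]; abel
      rw [hf', hzx]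
      simp only [hRdef, ← hy, sub_apply, map_add, map_smul, smul_apply, id, one_smul]
      simp only [mul_sub, sub_mul, add_mul, smul_sub, smul_add, smul_mul_assoc,
        mul_smul_comm, mul_assoc]
      abel
    refine le_trans (le_of_eq (congrArg norm e)) ?_
    refine (norm_add_le _ _).trans (add_le_add ?_ ?_)
    · refine (norm_mul_le _ _).trans ?_
      exact mul_le_of_le_one_left (norm_nonneg _) (hA t ht)
    · have h1 : ‖(Θ w - Θ y - Θ' y (t • h)) (x - x₀)‖ ≤ L * ‖h‖ * ‖h‖ * 1 :=
        (ContinuousLinearMap.le_opNorm _ _).trans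
          (mul_le_mul (htaylor t ht) (hxr.trans hr1) (norm_nonneg _) (by positivity))
      have h2 : ‖(Θ w - Θ y) h‖ ≤ L * ‖h‖ * ‖h‖ :=
        (ContinuousLinearMap.le_opNorm _ _).trans
          (mul_le_mul_of_nonneg_right (hΔ t ht) (norm_nonneg _))
      have h3 : ‖Θ y h‖ ≤ K * ‖h‖ :=
        (ContinuousLinearMap.le_opNorm _ _).trans
          (mul_le_mul_of_nonneg_right (hK _ (hmem x hx t ht)) (norm_nonneg _))
      have h4 : ‖t • Θ' y h (x - x₀)‖ ≤ L * ‖h‖ := by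
        have h5 : ‖Θ' y h (x - x₀)‖ ≤ L * ‖h‖ * 1 := by
          refine ((Θ' y h).le_opNorm _).trans (mul_le_mul ?_ (hxr.trans hr1) (norm_nonneg _)
            (by positivity))
          exact ((Θ' y).le_opNorm h).trans
            (mul_le_mul_of_nonneg_right (hM _ (hmem x hx t ht)) (norm_nonneg _))
        rw [norm_smul, Real.norm_of_nonneg ht.1]
        exact (mul_le_of_le_one_left (norm_nonneg _) ht.2).trans (by simpa using h5)
      have h6 := mul_le_mul ((norm_add_le _ _).trans (add_le_add h1 h2)) (hqb t ht)
        (norm_nonneg _) (by positivity)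
      have h7 := mul_le_mul ((norm_add_le _ _).trans (add_le_add h3 h4)) (hS t ht)
        (norm_nonneg _) (by positivity)
      refine (norm_add_le _ _).trans ((add_le_add ((norm_mul_le _ _).trans h6)
        ((norm_mul_le _ _).trans h7)).trans (le_of_eq ?_))
      ring
  have := hR 1 (by simp)
  simp only [hRdef, one_smul, add_sub_cancel] at this
  refine this.trans (le_of_eq ?_)
  ring

/-- A flat connection has a local invertible parallel section. -/
theorem exists_local_parallel [CompleteSpace 𝔸] [NormOneClass 𝔸] {Θ : E → E →L[ℝ] 𝔸} {U : Set E}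
    (hU : IsOpen U) (hΘ : ContDiffOn ℝ 2 Θ U)
    (hflat : ∀ y ∈ U, ∀ a b,
      fderiv ℝ Θ y a b + Θ y b * Θ y a = fderiv ℝ Θ y b a + Θ y a * Θ y b)
    {x₀ : E} (hx₀ : x₀ ∈ U) :
    ∃ r > 0, ball x₀ r ⊆ U ∧ ∃ P : E → 𝔸, ∀ x ∈ ball x₀ r,
      HasFDerivAt P (((ContinuousLinearMap.mul ℝ 𝔸).flip (P x)).comp (Θ x)) x ∧ IsUnit (P x) := by
  have h2 : ContDiffAt ℝ 2 Θ x₀ := hΘ.contDiffAt (hU.mem_nhds hx₀)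
  obtain ⟨L₁, s₁, hs₁, hL₁⟩ := (h2.of_le (by norm_num : (1 : ℕ∞ω) ≤ 2)).exists_lipschitzOnWith
  obtain ⟨L₂, s₂, hs₂, hL₂⟩ :=
    (h2.fderiv_right (m := 1) (by norm_num)).exists_lipschitzOnWith
  have hc₁ : ∀ᶠ y in nhds x₀, ‖Θ y‖ < ‖Θ x₀‖ + 1 :=
    h2.continuousAt.norm.eventually_lt_const (by linarith)
  have hc₂ : ∀ᶠ y in nhds x₀, ‖fderiv ℝ Θ y‖ < ‖fderiv ℝ Θ x₀‖ + 1 :=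
    (h2.fderiv_right (m := 1) (by norm_num)).continuousAt.norm.eventually_lt_const (by linarith)
  obtain ⟨ρ, hρ, hρs⟩ := Metric.mem_nhds_iff.1
    (Filter.inter_mem (Filter.inter_mem (hU.mem_nhds hx₀) (Filter.inter_mem hs₁ hs₂))
      (Filter.inter_mem hc₁ hc₂))
  set K := ‖Θ x₀‖ + 1
  have hK0 : 0 < K := by positivity
  -- Small enough for the Lipschitz and norm bounds (`ρ`), for `‖x - x₀‖ ≤ 1`, and for `K r ≤ 1/4`,
  -- which keeps the radial solutions within 1/2 of 1 and so invertible.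
  set r := min ρ (min 1 (1 / (4 * K)))
  have hr : 0 < r := by positivity
  have hrρ : ball x₀ r ⊆ ball x₀ ρ := ball_subset_ball (min_le_left _ _)
  have hKr : K * r ≤ 1 / 4 := by
    have : r ≤ 1 / (4 * K) := (min_le_right _ _).trans (min_le_right _ _)
    calc K * r ≤ K * (1 / (4 * K)) := by gcongr
      _ = 1 / 4 := by field_simp
  have hUb : ball x₀ r ⊆ U := fun y hy => (hρs (hrρ hy)).1.1
  have hd : ∀ y ∈ U, HasFDerivAt Θ (fderiv ℝ Θ y) y := fun y hy =>
    ((hΘ.contDiffAt (hU.mem_nhds hy)).differentiableAt (by norm_num)).hasFDerivAt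
  have hKb : ∀ y ∈ ball x₀ r, ‖Θ y‖ ≤ K := fun y hy => (hρs (hrρ hy)).2.1.le
  have hex := fun x (hx : x ∈ ball x₀ r) =>
    exists_radial_solution (hΘ.continuousOn.mono hUb) hKb hKr hx
  choose! Q hQ0 hQd hQb using hex
  have hQ2 : ∀ x ∈ ball x₀ r, ∀ t ∈ Icc (0 : ℝ) 1, ‖Q x t‖ ≤ 2 := fun x hx t ht => by
    calc ‖Q x t‖ = ‖(Q x t - 1) + 1‖ := by simp
      _ ≤ ‖Q x t - 1‖ + ‖(1 : 𝔸)‖ := norm_add_le _ _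
      _ ≤ 2 := by rw [norm_one]; linarith [hQb x hx t ht]
  set L : ℝ := max (max (L₁ : ℝ) L₂) (‖fderiv ℝ Θ x₀‖ + 1)
  have hL0 : 0 ≤ L := le_max_of_le_right (by positivity)
  refine ⟨r, hr, hUb, fun x => Q x 1, fun x hx => ⟨?_, ?_⟩⟩
  · rw [hasFDerivAt_iff_isLittleO]
    refine Asymptotics.IsBigO.trans_isLittleO (g := fun z => ‖z - x‖ ^ 2) ?_ ?_
    · refine Asymptotics.IsBigO.of_bound (8 * L + 8 * (L + K) * (L + K)) ?_
      filter_upwards [isOpen_ball.mem_nhds hx] with z hz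
      have := norm_radial_solution_sub_le (Θ := Θ) (Θ' := fderiv ℝ Θ) (L := L) hL0
        (fun y hy => hd y (hUb hy)) hKb hKr ((min_le_right _ _).trans (min_le_left _ _))
        (fun y hy z hz => ?_) (fun y hy z hz => ?_) (fun y hy => ?_)
        (fun y hy => hflat y (hUb hy)) hx hz (hQ0 x hx) (hQ0 z hz) (hQd x hx) (hQd z hz)
        (hQ2 z hz)
      · simpa [sub_mul] using this
      · rw [← dist_eq_norm, ← dist_eq_norm]
        exact (hL₁.dist_le_mul z (hρs (hrρ hz)).1.2.1 y (hρs (hrρ hy)).1.2.1).trans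
          (mul_le_mul_of_nonneg_right ((le_max_left _ _).trans (le_max_left _ _)) dist_nonneg)
      · rw [← dist_eq_norm z, ← dist_eq_norm (fderiv ℝ Θ z)]
        exact (hL₂.dist_le_mul z (hρs (hrρ hz)).1.2.2 y (hρs (hrρ hy)).1.2.2).trans
          (mul_le_mul_of_nonneg_right ((le_max_right _ _).trans (le_max_left _ _)) dist_nonneg)
      · exact (hρs (hrρ hy)).2.2.le.trans (le_max_right _ _)
    · exact Asymptotics.isLittleO_pow_sub_sub x one_lt_two
  · have : ‖1 - Q x 1‖ < 1 := by
      rw [norm_sub_rev]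
      exact (hQb x hx 1 (by simp)).trans_lt (by norm_num)
    simpa using isUnit_one_sub_of_norm_lt_one this

end FlatConnectionLocal

/-! ### Gluing local parallel sections over a simply connected set. -/

section FlatConnectionGlobal

open Set Metric Topology

/-- A bundle over a simply connected space whose transition functions are locally constant has a
locally constant section through every point. -/
theorem exists_locally_constant_section {B ι F : Type*} [TopologicalSpace B]
    [SimplyConnectedSpace B] [LocallyPathConnectedSpace B] (U : ι → Set B)
    (hU : ∀ i, IsOpen (U i)) (idx : B → ι) (hidx : ∀ b, b ∈ U (idx b)) (g : ι → ι → B → F → F)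
    (hself : ∀ i, ∀ b ∈ U i, ∀ v, g i i b v = v)
    (hcomp : ∀ i j k, ∀ b ∈ U i ∩ U j ∩ U k, ∀ v, g j k b (g i j b v) = g i k b v)
    (hloc : ∀ i j v, ∀ b ∈ U i ∩ U j, ∀ᶠ b' in 𝓝 b, g i j b' v = g i j b v) (b₀ : B) (v₀ : F) :
    ∃ σ : B → F, σ b₀ = v₀ ∧
      ∀ i, ∀ b ∈ U i, ∀ᶠ b' in 𝓝 b, g (idx b') i b' (σ b') = g (idx b) i b (σ b) := by
  -- With the discrete topology on the fibre, locally constant transition functions are continuous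
  -- and the bundle is a covering. Lifting the identity of the simply connected base gives a
  -- section, and continuity into a discrete fibre means local constancy.
  let _ : TopologicalSpace F := ⊥
  have : DiscreteTopology F := ⟨rfl⟩
  let Z : FiberBundleCore ι B F :=
    { baseSet := U
      isOpen_baseSet := hU
      indexAt := idx
      mem_baseSet_at := hidx
      coordChange := g
      coordChange_self := hself
      continuousOn_coordChange := fun i j => by
        rintro ⟨b, v⟩ ⟨hb, -⟩
        refine ContinuousAt.continuousWithinAt ?_
        have : (fun p : B × F => g i j p.1 p.2) =ᶠ[𝓝 (b, v)] fun _ => g i j b v := by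
          rw [nhds_prod_eq, nhds_discrete F]
          have := (hloc i j v b hb).prod_mk (Filter.eventually_pure.2 (rfl : v = v) :
            ∀ᶠ w in pure v, w = v)
          filter_upwards [this] with p hp
          rw [hp.2, hp.1]
        exact (continuousAt_const.congr this.symm)
      coordChange_comp := hcomp }
  have hcov : IsCoveringMap (Bundle.TotalSpace.proj : Bundle.TotalSpace F Z.Fiber → B) :=
    FiberBundle.isCoveringMap
  obtain ⟨s, ⟨hs0, hs⟩, -⟩ := hcov.existsUnique_continuousMap_lifts (ContinuousMap.id B) b₀
    ⟨b₀, v₀⟩ rfl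
  have hproj : ∀ b, (s b).proj = b := fun b => congrFun hs b
  refine ⟨fun b => (s b).2, ?_, fun i b hb => ?_⟩
  · have : ∀ p : Bundle.TotalSpace F Z.Fiber, p = ⟨b₀, v₀⟩ → (p.2 : F) = v₀ := by
      rintro _ rfl
      rfl
    exact this _ hs0
  · have hc : ContinuousAt (fun b' => (Z.localTriv i (s b')).2) b := by
      refine ContinuousAt.snd ((Z.localTriv i).continuousOn.continuousAt ?_ |>.comp
        s.continuous.continuousAt)
      refine (Z.localTriv i).open_source.mem_nhds ?_
      rw [FiberBundleCore.mem_localTriv_source, hproj]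
      exact hb
    have h2 := hc.eventually (p := fun w => w = (Z.localTriv i (s b)).2)
      (by rw [nhds_discrete F]; exact Filter.eventually_pure.2 rfl)
    have h3 : ∀ b', (Z.localTriv i (s b')).2 = g (idx b') i b' (s b').2 := fun b' => by
      rw [FiberBundleCore.localTriv_apply, hproj]
    simpa only [h3] using h2

variable {E : Type*} [NormedAddCommGroup E] [NormedSpace ℝ E]
  {𝔸 : Type*} [NormedRing 𝔸] [NormedAlgebra ℝ 𝔸]

/-- Two parallel sections on a convex open set differ by a constant factor on the right. -/
theorem inverse_mul_eq_of_parallel [CompleteSpace 𝔸] {Θ : E → E →L[ℝ] 𝔸} {s : Set E}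
    (hs : Convex ℝ s) {P Q : E → 𝔸}
    (hP : ∀ x ∈ s, HasFDerivAt P (((ContinuousLinearMap.mul ℝ 𝔸).flip (P x)).comp (Θ x)) x)
    (hQ : ∀ x ∈ s, HasFDerivAt Q (((ContinuousLinearMap.mul ℝ 𝔸).flip (Q x)).comp (Θ x)) x)
    (hu : ∀ x ∈ s, IsUnit (Q x)) {x y : E} (hx : x ∈ s) (hy : y ∈ s) :
    Ring.inverse (Q y) * P y = Ring.inverse (Q x) * P x := by
  -- In `(Q⁻¹ P)' = -Q⁻¹ (Θ Q) Q⁻¹ P + Q⁻¹ Θ P` the two terms cancel.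
  have hd : ∀ z ∈ s, HasFDerivAt (fun z => Ring.inverse (Q z) * P z) (0 : E →L[ℝ] 𝔸) z := by
    intro z hz
    obtain ⟨w, hw⟩ := hu z hz
    have hi : HasFDerivAt Ring.inverse (-ContinuousLinearMap.mulLeftRight ℝ 𝔸 ↑w⁻¹ ↑w⁻¹) (Q z) := by
      rw [← hw]; exact hasFDerivAt_ringInverse w
    have h1 := (hi.comp z (hQ z hz)).mul' (hP z hz)
    refine h1.congr_fderiv ?_
    ext a
    simp [← hw, mul_assoc]
  have := hs.norm_image_sub_le_of_norm_hasFDerivWithin_le (C := 0)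
    (fun z hz => (hd z hz).hasFDerivWithinAt) (by simp) hx hy
  simpa [sub_eq_zero] using this

/-- A flat connection on a simply connected open set has a parallel section with value `1` at a
given point. -/
theorem exists_parallel [CompleteSpace 𝔸] [NormOneClass 𝔸] {Θ : E → E →L[ℝ] 𝔸} {U : Set E}
    (hU : IsOpen U) (hsc : IsSimplyConnected U) (hΘ : ContDiffOn ℝ 2 Θ U)
    (hflat : ∀ y ∈ U, ∀ a b,
      fderiv ℝ Θ y a b + Θ y b * Θ y a = fderiv ℝ Θ y b a + Θ y a * Θ y b)
    {x₀ : E} (hx₀ : x₀ ∈ U) :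
    ∃ P : E → 𝔸, P x₀ = 1 ∧ ∀ x ∈ U,
      HasFDerivAt P (((ContinuousLinearMap.mul ℝ 𝔸).flip (P x)).comp (Θ x)) x := by
  classical
  have hex := fun x (hx : x ∈ U) => exists_local_parallel hU hΘ hflat hx
  choose! r hr hrU P hP using hex
  have := hsc.simplyConnectedSpace
  have := hU.locallyPathConnectedSpace
  -- Charts are the balls carrying the local sections `P i`. The transition `P_j⁻¹ P_i` is constant
  -- on each overlap, which is convex. A locally constant section `σ` is a consistent choice of
  -- right factors; its initial value normalizes the result to 1 at `x₀`.
  obtain ⟨σ, hσ0, hσ⟩ := exists_locally_constant_section (B := U) (ι := U) (F := 𝔸)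
    (fun i => {b | (b : E) ∈ ball (i : E) (r i)})
    (fun i => isOpen_ball.preimage continuous_subtype_val) id
    (fun b => mem_ball_self (hr b b.2))
    (fun i j b v => Ring.inverse (P j b) * P i b * v)
    (fun i b hb v => by
      rw [Ring.inverse_mul_cancel _ (hP i i.2 b hb).2, one_mul])
    (fun i j k b hb v => by
      have := Ring.mul_inverse_cancel _ (hP j j.2 b hb.1.2).2
      rw [← mul_assoc, ← mul_assoc, mul_assoc (Ring.inverse (P k b)), this, mul_one])
    (fun i j v b hb => by
      have hopen : IsOpen {b : U | (b : E) ∈ ball (i : E) (r i) ∩ ball (j : E) (r j)} :=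
        (isOpen_ball.inter isOpen_ball).preimage continuous_subtype_val
      filter_upwards [hopen.mem_nhds hb] with b' hb'
      rw [inverse_mul_eq_of_parallel ((convex_ball (i : E) (r i)).inter (convex_ball (j : E) (r j)))
        (fun x hx => (hP i i.2 x hx.1).1) (fun x hx => (hP j j.2 x hx.2).1)
        (fun x hx => (hP j j.2 x hx.2).2) hb hb'])
    ⟨x₀, hx₀⟩ (Ring.inverse (P x₀ x₀))
  refine ⟨fun x => if hx : x ∈ U then P x x * σ ⟨x, hx⟩ else 0, ?_, fun x hx => ?_⟩
  · simp only [hx₀, dif_pos, hσ0]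
    exact Ring.mul_inverse_cancel _ (hP x₀ hx₀ x₀ (mem_ball_self (hr x₀ hx₀))).2
  · have hxb : x ∈ ball x (r x) := mem_ball_self (hr x hx)
    have h1 := hσ ⟨x, hx⟩ ⟨x, hx⟩ hxb
    -- Though defined with a different local section at every point, the glued map coincides near
    -- `x` with the single parallel section `P x · σ(x)`.
    have hev : (fun y => if hy : y ∈ U then P y y * σ ⟨y, hy⟩ else 0)
        =ᶠ[𝓝 x] fun y => P x y * σ ⟨x, hx⟩ := by
      have h2 : ∀ᶠ y in 𝓝 x, ∀ hy : y ∈ U,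
          Ring.inverse (P x y) * P y y * σ ⟨y, hy⟩ = σ ⟨x, hx⟩ := by
        rw [← hU.isOpenEmbedding_subtypeVal.map_nhds_eq ⟨x, hx⟩, Filter.eventually_map]
        filter_upwards [h1] with y hy _
        simpa [Ring.inverse_mul_cancel _ (hP x hx x hxb).2] using hy
      filter_upwards [h2, hU.mem_nhds hx, isOpen_ball.mem_nhds hxb] with y hy hyU hyb
      rw [dif_pos hyU, ← hy hyU, ← mul_assoc, ← mul_assoc,
        Ring.mul_inverse_cancel _ (hP x hx y hyb).2, one_mul]
    refine HasFDerivAt.congr_of_eventuallyEq ?_ hev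
    refine ((hP x hx x hxb).1.mul_const' (σ ⟨x, hx⟩)).congr_fderiv ?_
    ext a
    simp [hx, mul_assoc]

end FlatConnectionGlobal

/-! ### Calculus of partial derivatives on `ℝ³`. -/

section CoordinateDerivatives

open Set

/-- Euclidean coordinate space `ℝ³`. -/
abbrev E3 : Type := EuclideanSpace ℝ (Fin 3)

variable {F : Type*} [NormedAddCommGroup F] [NormedSpace ℝ F]

/-- The partial derivative in the direction of the `i`-th coordinate. -/
def pd (i : Fin 3) (φ : E3 → F) (x : E3) : F := fderiv ℝ φ x (EuclideanSpace.single i (1 : ℝ))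

variable {U : Set E3} {x : E3}

theorem fderiv_apply_eq_sum_pd (φ : E3 → F) (x a : E3) :
    fderiv ℝ φ x a = ∑ i, a i • pd i φ x := by
  have : a = ∑ i, a i • EuclideanSpace.single i (1 : ℝ) := by
    ext j
    simp [Pi.single_apply]
  conv_lhs => rw [this]
  simp [pd]

theorem differentiableAt_of_contDiffOn (hU : IsOpen U) {φ : E3 → F} (h : ContDiffOn ℝ ∞ φ U)
    (hx : x ∈ U) : DifferentiableAt ℝ φ x :=
  (h.contDiffAt (hU.mem_nhds hx)).differentiableAt (by simp)

theorem contDiffOn_pd (hU : IsOpen U) {φ : E3 → F} (h : ContDiffOn ℝ ∞ φ U) (i : Fin 3) :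
    ContDiffOn ℝ ∞ (pd i φ) U :=
  (h.fderiv_of_isOpen hU (by simp)).clm_apply contDiffOn_const

theorem pd_comm (hU : IsOpen U) {φ : E3 → F} (h : ContDiffOn ℝ ∞ φ U) (hx : x ∈ U)
    (i j : Fin 3) : pd i (pd j φ) x = pd j (pd i φ) x := by
  have h2 : ContDiffAt ℝ 2 φ x := (h.contDiffAt (hU.mem_nhds hx)).of_le (by norm_cast)
  have hs : IsSymmSndFDerivAt ℝ φ x := h2.isSymmSndFDerivAt (by simp)
  have hd : DifferentiableAt ℝ (fderiv ℝ φ) x :=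
    (h2.fderiv_right (m := 1) (by norm_num)).differentiableAt (by norm_num)
  have e : ∀ i j, pd i (pd j φ) x = fderiv ℝ (fderiv ℝ φ) x (EuclideanSpace.single i 1)
      (EuclideanSpace.single j 1) := fun i j => by
    have := (hd.hasFDerivAt.clm_apply
      (hasFDerivAt_const (EuclideanSpace.single j (1 : ℝ) : E3) x)).fderiv
    unfold pd
    rw [this]
    simp
  rw [e, e]
  exact hs.eq _ _

theorem pd_congr (hU : IsOpen U) {φ ψ : E3 → F} (h : ∀ y ∈ U, φ y = ψ y) (hx : x ∈ U)
    (i : Fin 3) : pd i φ x = pd i ψ x := by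
  unfold pd
  rw [Filter.EventuallyEq.fderiv_eq]
  filter_upwards [hU.mem_nhds hx] with y hy using h y hy

theorem pd_eq_zero_of_const (hU : IsOpen U) {φ : E3 → F} {a : F} (h : ∀ y ∈ U, φ y = a)
    (hx : x ∈ U) (i : Fin 3) : pd i φ x = 0 := by
  rw [pd_congr (ψ := fun _ => a) hU h hx]
  simp [pd]

theorem pd_bilin {V : Type*} [NormedAddCommGroup V] [NormedSpace ℝ V] (B : V →L[ℝ] V →L[ℝ] F)
    {Y Z : E3 → V} (hY : DifferentiableAt ℝ Y x) (hZ : DifferentiableAt ℝ Z x) (i : Fin 3) :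
    pd i (fun y => B (Y y) (Z y)) x = B (pd i Y x) (Z x) + B (Y x) (pd i Z x) := by
  unfold pd
  rw [(B.hasFDerivAt_of_bilinear hY.hasFDerivAt hZ.hasFDerivAt).fderiv]
  simp [add_comm]

theorem pd_smul {a : E3 → ℝ} {Y : E3 → F} (ha : DifferentiableAt ℝ a x)
    (hY : DifferentiableAt ℝ Y x) (i : Fin 3) :
    pd i (fun y => a y • Y y) x = pd i a x • Y x + a x • pd i Y x := by
  unfold pd
  rw [(ha.hasFDerivAt.fun_smul hY.hasFDerivAt).fderiv]
  simp [add_comm]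

theorem pd_mul {a b : E3 → ℝ} (ha : DifferentiableAt ℝ a x)
    (hb : DifferentiableAt ℝ b x) (i : Fin 3) :
    pd i (fun y => a y * b y) x = pd i a x * b x + a x * pd i b x :=
  pd_smul ha hb i

theorem pd_const_mul {a : E3 → ℝ} (r : ℝ) (ha : DifferentiableAt ℝ a x) (i : Fin 3) :
    pd i (fun y => r * a y) x = r * pd i a x := by
  unfold pd
  rw [(ha.hasFDerivAt.const_mul r).fderiv]
  simp

theorem pd_neg (a : E3 → F) (i : Fin 3) : pd i (fun y => -a y) x = -pd i a x := by
  unfold pd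
  rw [fderiv_fun_neg]
  simp

theorem pd_const (a : F) (i : Fin 3) : pd i (fun _ => a) x = 0 := by
  simp [pd]

theorem pd_sub {a b : E3 → F} (ha : DifferentiableAt ℝ a x)
    (hb : DifferentiableAt ℝ b x) (i : Fin 3) :
    pd i (fun y => a y - b y) x = pd i a x - pd i b x := by
  unfold pd
  rw [fderiv_fun_sub ha hb]
  simp

theorem pd_add {a b : E3 → F} (ha : DifferentiableAt ℝ a x)
    (hb : DifferentiableAt ℝ b x) (i : Fin 3) :
    pd i (fun y => a y + b y) x = pd i a x + pd i b x := by
  unfold pd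
  rw [fderiv_fun_add ha hb]
  simp

end CoordinateDerivatives

/-! ### Structure equations of a principal frame: Codazzi, Darboux and Gauss. -/

section FrameEquations

variable {V : Type*} [NormedAddCommGroup V] [NormedSpace ℝ V]

/-- A principal frame of a holonomic hypersurface in coordinates: `F` is the hypersurface, `N` its
unit normal field, `X` the normalized coordinate fields and `(v, W)` the associated pair. -/
structure PrincipalFrame (B : V →L[ℝ] V →L[ℝ] ℝ) (c ε : ℝ) (U : Set E3) (F N : E3 → V)
    (X : Fin 3 → E3 → V) (v W : Fin 3 → E3 → ℝ) : Prop where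
  isOpen : IsOpen U
  symm : ∀ y z, B y z = B z y
  c_ne : c ≠ 0
  ε_sq : ε * ε = 1
  smooth_F : ContDiffOn ℝ ∞ F U
  smooth_N : ContDiffOn ℝ ∞ N U
  smooth_X : ∀ i, ContDiffOn ℝ ∞ (X i) U
  smooth_v : ∀ i, ContDiffOn ℝ ∞ (v i) U
  smooth_W : ∀ i, ContDiffOn ℝ ∞ (W i) U
  v_ne : ∀ i, ∀ x ∈ U, v i x ≠ 0
  pd_F : ∀ i, ∀ x ∈ U, pd i F x = v i x • X i x
  pd_N : ∀ i, ∀ x ∈ U, pd i N x = -(W i x • X i x)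
  X_X : ∀ i j, ∀ x ∈ U, B (X i x) (X j x) = if i = j then 1 else 0
  F_F : ∀ x ∈ U, B (F x) (F x) = c⁻¹
  N_N : ∀ x ∈ U, B (N x) (N x) = ε
  N_F : ∀ x ∈ U, B (N x) (F x) = 0
  X_F : ∀ i, ∀ x ∈ U, B (X i x) (F x) = 0
  X_N : ∀ i, ∀ x ∈ U, B (X i x) (N x) = 0
  nondeg : ∀ x ∈ U, ∀ z, B z (F x) = 0 → B z (N x) = 0 → (∀ i, B z (X i x) = 0) → z = 0

/-- The rotation coefficients `h_ij = v_i⁻¹ ∂_i v_j`. -/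
def rot (v : Fin 3 → E3 → ℝ) (i j : Fin 3) (x : E3) : ℝ := pd i (v j) x / v i x

namespace PrincipalFrame

variable {B : V →L[ℝ] V →L[ℝ] ℝ} {c ε : ℝ} {U : Set E3} {F N : E3 → V}
  {X : Fin 3 → E3 → V} {v W : Fin 3 → E3 → ℝ} (H : PrincipalFrame B c ε U F N X v W) {x : E3}
include H

theorem pd_v (hx : x ∈ U) (i j : Fin 3) : pd i (v j) x = rot v i j x * v i x := by
  unfold rot
  field_simp [H.v_ne i x hx]

theorem smooth_rot (i j : Fin 3) : ContDiffOn ℝ ∞ (rot v i j) U :=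
  (contDiffOn_pd H.isOpen (H.smooth_v j) i).div (H.smooth_v i) (H.v_ne i)

theorem dX (hx : x ∈ U) (i : Fin 3) : DifferentiableAt ℝ (X i) x :=
  differentiableAt_of_contDiffOn H.isOpen (H.smooth_X i) hx

theorem dpdX (hx : x ∈ U) (i j : Fin 3) : DifferentiableAt ℝ (pd i (X j)) x :=
  differentiableAt_of_contDiffOn H.isOpen (contDiffOn_pd H.isOpen (H.smooth_X j) i) hx

theorem pdX_X_skew (hx : x ∈ U) (i j k : Fin 3) :
    B (pd i (X j) x) (X k x) = -B (pd i (X k) x) (X j x) := by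
  have h := pd_bilin B (H.dX hx j) (H.dX hx k) i
  rw [pd_eq_zero_of_const H.isOpen (H.X_X j k) hx, H.symm (X j x)] at h
  linarith

theorem pdX_F (hx : x ∈ U) (i j : Fin 3) :
    B (pd i (X j) x) (F x) = if i = j then -v i x else 0 := by
  have h := pd_bilin B (H.dX hx j) (differentiableAt_of_contDiffOn H.isOpen H.smooth_F hx) i
  rw [pd_eq_zero_of_const H.isOpen (H.X_F j) hx, H.pd_F i x hx, map_smul, H.X_X j i x hx] at h
  split_ifs with hij
  · rw [if_pos hij.symm] at h
    simp at h; linarith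
  · rw [if_neg (Ne.symm hij)] at h
    simp at h; linarith

theorem pdX_N (hx : x ∈ U) (i j : Fin 3) :
    B (pd i (X j) x) (N x) = if i = j then W i x else 0 := by
  have h := pd_bilin B (H.dX hx j) (differentiableAt_of_contDiffOn H.isOpen H.smooth_N hx) i
  rw [pd_eq_zero_of_const H.isOpen (H.X_N j) hx, H.pd_N i x hx, map_neg, map_smul,
    H.X_X j i x hx] at h
  split_ifs with hij
  · rw [if_pos hij.symm] at h
    simp at h; linarith
  · rw [if_neg (Ne.symm hij)] at h
    simp at h; linarith

/-- Symmetry of the second derivatives of `F`, written in the frame: the torsion-free condition.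
Together with the skewness `pdX_X_skew` it determines the connection coefficients. -/
theorem pd_pd_F (hx : x ∈ U) (i j : Fin 3) :
    pd i (v j) x • X j x + v j x • pd i (X j) x
      = pd j (v i) x • X i x + v i x • pd j (X i) x := by
  have h := pd_comm H.isOpen H.smooth_F hx i j
  rw [pd_congr H.isOpen (H.pd_F j) hx, pd_congr H.isOpen (H.pd_F i) hx,
    pd_smul (differentiableAt_of_contDiffOn H.isOpen (H.smooth_v j) hx) (H.dX hx j),
    pd_smul (differentiableAt_of_contDiffOn H.isOpen (H.smooth_v i) hx) (H.dX hx i)] at h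
  exact h

theorem pd_pd_N (hx : x ∈ U) (i j : Fin 3) :
    pd i (W j) x • X j x + W j x • pd i (X j) x
      = pd j (W i) x • X i x + W i x • pd j (X i) x := by
  have h := pd_comm H.isOpen H.smooth_N hx i j
  rw [pd_congr H.isOpen (H.pd_N j) hx, pd_congr H.isOpen (H.pd_N i) hx, pd_neg, pd_neg,
    pd_smul (differentiableAt_of_contDiffOn H.isOpen (H.smooth_W j) hx) (H.dX hx j),
    pd_smul (differentiableAt_of_contDiffOn H.isOpen (H.smooth_W i) hx) (H.dX hx i)] at h
  exact neg_injective h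

/-- The connection coefficients of the frame. -/
theorem pdX_X (hx : x ∈ U) (i j k : Fin 3) :
    B (pd i (X j) x) (X k x)
      = (if i = k then rot v j i x else 0) - if i = j then rot v k i x else 0 := by
  have sk := H.pdX_X_skew hx
  have tor : ∀ i j k, B (pd i (v j) x • X j x + v j x • pd i (X j) x) (X k x)
      = B (pd j (v i) x • X i x + v i x • pd j (X i) x) (X k x) := fun i j k => by
    rw [H.pd_pd_F hx i j]
  simp only [map_add, map_smul, add_apply, smul_apply, H.X_X _ _ x hx, smul_eq_mul,
    H.pd_v hx] at tor
  have key : ∀ i j, i ≠ j → B (pd i (X j) x) (X i x) = rot v j i x := fun i j hij => by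
    have h1 := tor i j i
    have h2 := sk j i i
    rw [if_neg hij.symm, if_pos rfl] at h1
    have h3 := H.v_ne j x hx
    apply mul_left_cancel₀ h3
    linear_combination h1 + (v i x / 2) * h2
  by_cases hij : i = j
  · subst hij
    by_cases hik : i = k
    · subst hik
      have := sk i i i
      simp
      linarith
    · rw [sk, key i k hik, if_neg hik, if_pos rfl]
      ring
  · by_cases hik : i = k
    · subst hik
      rw [key i j hij, if_neg hij, if_pos rfl]
      ring
    · rw [if_neg hij, if_neg hik, sub_zero]
      by_cases hjk : j = k
      · subst hjk
        have := sk i j j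
        linarith
      -- For distinct indices the coefficient divided by `v i` is symmetric in the first two indices
      -- and skew in the last two. Cycling through the three indices shows that it vanishes.
      · have t1 := tor i j k
        have t2 := tor j k i
        have t3 := tor k i j
        simp only [if_neg hij, if_neg hik, if_neg hjk, if_neg (Ne.symm hij), if_neg (Ne.symm hik),
          if_neg (Ne.symm hjk), mul_zero, zero_add] at t1 t2 t3
        have s1 := sk i j k
        have s2 := sk j k i
        have s3 := sk k i j
        have n1 := H.v_ne i x hx
        have n2 := H.v_ne j x hx
        have n3 := H.v_ne k x hx
        apply mul_left_cancel₀ (mul_ne_zero n2 n3)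
        rw [s1] at t1
        rw [s2] at t2
        rw [s3] at t3
        linear_combination (v j x * v k x) * s1 + (v k x / 2) * t1 - (v i x / 2) * t2
          + (v j x / 2) * t3

/-- Derivative of a frame field along another coordinate. -/
theorem pdX_of_ne (hx : x ∈ U) {i j : Fin 3} (hij : i ≠ j) :
    pd i (X j) x = rot v j i x • X i x := by
  rw [← sub_eq_zero]
  refine H.nondeg x hx _ ?_ ?_ fun k => ?_
  · simp [H.pdX_F hx, H.X_F i x hx, hij]
  · simp [H.pdX_N hx, H.X_N i x hx, hij]
  · simp [H.pdX_X hx, H.X_X _ _ x hx, hij]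

/-- Derivative of a frame field along its own coordinate. -/
theorem pdX_self (hx : x ∈ U) (i : Fin 3) :
    pd i (X i) x = rot v i i x • X i x - ∑ k, rot v k i x • X k x + (ε * W i x) • N x
      - (c * v i x) • F x := by
  rw [← sub_eq_zero]
  refine H.nondeg x hx _ ?_ ?_ fun k => ?_
  · simp [H.pdX_F hx, H.X_F _ x hx, H.F_F x hx, H.N_F x hx]
    field_simp [H.c_ne]
    ring
  · simp [H.pdX_N hx, H.X_N _ x hx, H.N_N x hx, H.symm (F x), H.N_F x hx]
    linear_combination (-W i x) * H.ε_sq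
  · simp [H.pdX_X hx, H.X_X _ _ x hx, H.symm (F x), H.symm (N x), H.X_N _ x hx, H.X_F _ x hx]

/-- The `X j` component of the symmetry of the second derivatives of `N`. -/
theorem codazzi (hx : x ∈ U) {i j : Fin 3} (hij : i ≠ j) :
    pd i (W j) x = rot v i j x * W i x := by
  have h := congrArg (fun z => B z (X j x)) (H.pd_pd_N hx i j)
  simp [H.pdX_X hx, H.X_X _ _ x hx, hij, hij.symm] at h
  linarith

/-- The `X i` component of `∂_k ∂_i X_j = ∂_i ∂_k X_j`. It is computed by differentiating `B(∂_i
X_j, X_i) = h_ji` along `k` and `B(∂_k X_j, X_i) = 0` along `i`. -/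
theorem darboux (hx : x ∈ U) {i j k : Fin 3} (hij : i ≠ j) (hik : i ≠ k) (hjk : j ≠ k) :
    pd k (rot v j i) x = rot v j k x * rot v k i x := by
  have h1 := pd_bilin B (H.dpdX hx i j) (H.dX hx i) k
  have h2 := pd_bilin B (H.dpdX hx k j) (H.dX hx i) i
  rw [pd_congr (ψ := rot v j i) H.isOpen (fun y hy => by simp [H.pdX_X hy, hij]) hx,
    H.pdX_of_ne hx hij, H.pdX_of_ne hx hik.symm] at h1
  rw [pd_congr (ψ := fun _ => (0 : ℝ)) H.isOpen
    (fun y hy => by simp [H.pdX_X hy, hik.symm, hjk.symm]) hx, pd_const,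
    H.pdX_of_ne hx hjk.symm, pd_comm H.isOpen (H.smooth_X j) hx, H.symm _ (pd i (X i) x)] at h2
  simp [H.X_X _ _ x hx, H.pdX_X hx, hik] at h1 h2
  linarith

/-- The `X i` component of `∂_i ∂_j X_j = ∂_j ∂_i X_j`. The terms with `ε` and `c` come from the
components of `∂_i X_i` along the normal and along the position vector. -/
theorem gauss (hx : x ∈ U) {i j k : Fin 3} (hij : i ≠ j) (hik : i ≠ k) (hjk : j ≠ k) :
    pd i (rot v i j) x + pd j (rot v j i) x + rot v k i x * rot v k j x
      + ε * (W i x * W j x) + c * (v i x * v j x) = 0 := by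
  have h1 := pd_bilin B (H.dpdX hx j j) (H.dX hx i) i
  have h2 := pd_bilin B (H.dpdX hx i j) (H.dX hx i) j
  rw [pd_congr (ψ := fun y => -rot v i j y) H.isOpen
    (fun y hy => by simp [H.pdX_X hy, hij.symm]) hx, pd_neg, H.pdX_self hx i] at h1
  rw [pd_congr (ψ := rot v j i) H.isOpen (fun y hy => by simp [H.pdX_X hy, hij]) hx,
    H.pdX_of_ne hx hij, H.pdX_of_ne hx hij.symm, pd_comm H.isOpen (H.smooth_X j) hx] at h2
  have hsum : ∑ l, rot v l i x * B (pd j (X j) x) (X l x)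
      = -(rot v i i x * rot v i j x) - rot v k i x * rot v k j x := by
    have : (Finset.univ : Finset (Fin 3)) = {i, j, k} := by
      clear h1 h2
      revert i j k; decide
    rw [this, Finset.sum_insert (by simp [hij, hik]), Finset.sum_insert (by simp [hjk]),
      Finset.sum_singleton]
    simp [H.pdX_X hx, hij.symm, hjk]
    ring
  simp only [map_add, map_sub, map_sum, map_smul, smul_eq_mul, hsum] at h1
  simp [H.X_X _ _ x hx, H.pdX_X hx, H.pdX_F hx, H.pdX_N hx, hij, hij.symm] at h1 h2
  linarith

end PrincipalFrame

end FrameEquations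

/-! ### Completely integrable linear systems. -/

section LinearSystems

variable {U : Set E3} {n : ℕ}

/-- The solutions of a linear system with smooth coefficients are smooth. -/
theorem contDiffOn_of_linear_system (hU : IsOpen U) {m : Fin 3 → Fin n → Fin n → E3 → ℝ}
    (hm : ∀ i p q, ContDiffOn ℝ ∞ (m i p q) U) {y : Fin n → E3 → ℝ}
    (hd : ∀ p, ∀ x ∈ U, DifferentiableAt ℝ (y p) x)
    (hy : ∀ i p, ∀ x ∈ U, pd i (y p) x = ∑ q, m i p q x * y q x) (p : Fin n) :
    ContDiffOn ℝ ∞ (y p) U := by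
  rw [contDiffOn_infty]
  intro k
  induction k generalizing p with
  | zero =>
    exact contDiffOn_zero.2 fun x hx => (hd p x hx).continuousAt.continuousWithinAt
  | succ k ih =>
    have h := contDiffOn_succ_iff_fderiv_of_isOpen (𝕜 := ℝ) (n := (k : ℕ∞ω)) (f := y p) hU
    push_cast
    rw [h]
    refine ⟨fun x hx => (hd p x hx).differentiableWithinAt, by simp, ?_⟩
    have e : ∀ x ∈ U, fderiv ℝ (y p) x
        = ∑ i, (∑ q, m i p q x * y q x) • (EuclideanSpace.proj i : E3 →L[ℝ] ℝ) := by
      intro x hx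
      ext a
      rw [fderiv_apply_eq_sum_pd]
      simp [hy _ _ x hx, mul_comm]
    refine ContDiffOn.congr ?_ e
    refine ContDiffOn.sum fun i _ => ContDiffOn.fun_smul (ContDiffOn.sum fun q _ => ?_)
      contDiffOn_const
    exact ((hm i p q).of_le (by exact_mod_cast le_top)).mul (ih q)

section Algebra

variable {𝔸 : Type*} [NormedRing 𝔸] [NormedAlgebra ℝ 𝔸]

/-- A completely integrable linear system in a Banach algebra has a fundamental solution on a
simply connected open set. -/
theorem exists_fundamental_solution [CompleteSpace 𝔸] [NormOneClass 𝔸] (hU : IsOpen U)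
    (hsc : IsSimplyConnected U) {T : Fin 3 → E3 → 𝔸} (hT : ∀ i, ContDiffOn ℝ ∞ (T i) U)
    (hint : ∀ i k, ∀ x ∈ U,
      pd k (T i) x + T i x * T k x = pd i (T k) x + T k x * T i x)
    {x₀ : E3} (hx₀ : x₀ ∈ U) :
    ∃ P : E3 → 𝔸, P x₀ = 1 ∧ ∀ x ∈ U, DifferentiableAt ℝ P x ∧
      ∀ i, pd i P x = T i x * P x := by
  -- `Θ` is the connection form `∑ T_i du_i`; the integrability condition is its flatness tested on
  -- the coordinate fields.
  let S : Fin 3 → 𝔸 →L[ℝ] E3 →L[ℝ] 𝔸 := fun i =>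
    ContinuousLinearMap.smulRightL ℝ E3 𝔸 (EuclideanSpace.proj i)
  let Θ : E3 → E3 →L[ℝ] 𝔸 := fun x => ∑ i, S i (T i x)
  have hΘa : ∀ x a, Θ x a = ∑ i, a i • T i x := fun x a => by simp [Θ, S]
  have hΘ : ContDiffOn ℝ ∞ Θ U :=
    ContDiffOn.sum fun i _ => (S i).contDiff.comp_contDiffOn (hT i)
  have hΘ' : ∀ x ∈ U, ∀ a b, fderiv ℝ Θ x a b = ∑ i, ∑ k, (b i * a k) • pd k (T i) x := by
    intro x hx a b
    have h1 : HasFDerivAt (fun y => Θ y b) ((fderiv ℝ Θ x).flip b) x :=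
      (((hΘ.contDiffAt (hU.mem_nhds hx)).differentiableAt (by simp)).hasFDerivAt.clm_apply
        (hasFDerivAt_const b x)).congr_fderiv (by ext; simp)
    have h2 : HasFDerivAt (fun y => Θ y b) (∑ i, b i • fderiv ℝ (T i) x) x := by
      simp_rw [hΘa]
      exact HasFDerivAt.fun_sum fun i _ =>
        (differentiableAt_of_contDiffOn hU (hT i) hx).hasFDerivAt.fun_const_smul _
    have h3 := DFunLike.congr_fun (h1.unique h2) a
    rw [ContinuousLinearMap.flip_apply] at h3
    rw [h3]
    simp only [sum_apply, smul_apply, fderiv_apply_eq_sum_pd, Finset.smul_sum, smul_smul]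
  have hflat : ∀ x ∈ U, ∀ a b,
      fderiv ℝ Θ x a b + Θ x b * Θ x a = fderiv ℝ Θ x b a + Θ x a * Θ x b := by
    intro x hx a b
    have e1 : ∀ a b, fderiv ℝ Θ x a b + Θ x b * Θ x a = ∑ i, ∑ k, (b i * a k) •
        (pd k (T i) x + T i x * T k x) := fun a b => by
      rw [hΘ' x hx, hΘa, hΘa, Finset.sum_mul_sum, ← Finset.sum_add_distrib]
      refine Finset.sum_congr rfl fun i _ => ?_
      rw [← Finset.sum_add_distrib]
      refine Finset.sum_congr rfl fun k _ => ?_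
      rw [smul_add, smul_mul_smul_comm]
    rw [e1, e1, Finset.sum_comm]
    refine Finset.sum_congr rfl fun k _ => Finset.sum_congr rfl fun i _ => ?_
    rw [hint i k x hx, mul_comm]
  obtain ⟨P, hP0, hP⟩ := exists_parallel hU hsc (hΘ.of_le (by norm_cast)) hflat hx₀
  refine ⟨P, hP0, fun x hx => ⟨(hP x hx).differentiableAt, fun i => ?_⟩⟩
  unfold pd
  rw [(hP x hx).fderiv]
  simp [hΘa]

/-- Smoothness and partial derivatives of a matrix function that is represented in a normed
algebra. -/
theorem contDiffOn_and_pd_of_matrix (Φ : Matrix (Fin n) (Fin n) ℝ →ₗ[ℝ] 𝔸) (hU : IsOpen U)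
    {m : Fin n → Fin n → E3 → ℝ} (hm : ∀ p q, ContDiffOn ℝ ∞ (m p q) U) :
    ContDiffOn ℝ ∞ (fun x => Φ (Matrix.of fun p q => m p q x)) U ∧
    ∀ k, ∀ x ∈ U, pd k (fun x => Φ (Matrix.of fun p q => m p q x)) x
      = Φ (Matrix.of fun p q => pd k (m p q) x) := by
  have hΦsum : ∀ A : Matrix (Fin n) (Fin n) ℝ,
      Φ A = ∑ p, ∑ q, A p q • Φ (Matrix.single p q 1) := fun A => by
    conv_lhs => rw [Matrix.matrix_eq_sum_single A]
    simp_rw [map_sum, ← map_smul, Matrix.smul_single, smul_eq_mul, mul_one]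
  have e : (fun x => Φ (Matrix.of fun p q => m p q x))
      = fun x => ∑ p, ∑ q, m p q x • Φ (Matrix.single p q 1) := funext fun x => hΦsum _
  rw [e]
  refine ⟨ContDiffOn.sum fun p _ => ContDiffOn.sum fun q _ =>
      (hm p q).smul contDiffOn_const, fun k x hx => ?_⟩
  have h1 : HasFDerivAt (fun x => ∑ p, ∑ q, m p q x • Φ (Matrix.single p q 1))
      (∑ p, ∑ q, (fderiv ℝ (m p q) x).smulRight (Φ (Matrix.single p q 1))) x :=
    HasFDerivAt.fun_sum fun p _ => HasFDerivAt.fun_sum fun q _ =>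
      (differentiableAt_of_contDiffOn hU (hm p q) hx).hasFDerivAt.smul_const _
  rw [hΦsum]
  unfold pd
  rw [h1.fderiv]
  simp

end Algebra

/-- A completely integrable linear system on a simply connected open set of `ℝ³` has a solution
with any given initial value. -/
theorem exists_solution_of_integrable [NeZero n] (hU : IsOpen U) (hsc : IsSimplyConnected U)
    {m : Fin 3 → Fin n → Fin n → E3 → ℝ}
    (hm : ∀ i p q, ContDiffOn ℝ ∞ (m i p q) U)
    (hint : ∀ i k p q, ∀ x ∈ U, pd k (m i p q) x + ∑ r, m i p r x * m k r q x
      = pd i (m k p q) x + ∑ r, m k p r x * m i r q x)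
    {x₀ : E3} (hx₀ : x₀ ∈ U) (y₀ : Fin n → ℝ) :
    ∃ y : Fin n → E3 → ℝ, (∀ p, y p x₀ = y₀ p) ∧ (∀ p, ContDiffOn ℝ ∞ (y p) U) ∧
      ∀ i p, ∀ x ∈ U, pd i (y p) x = ∑ q, m i p q x * y q x := by
  -- Matrices become operators so that the operator norm makes them a Banach algebra with `‖1‖ = 1`;
  -- this is where `n ≠ 0` enters.
  let Φ : Matrix (Fin n) (Fin n) ℝ ≃ₐ[ℝ] ((Fin n → ℝ) →L[ℝ] (Fin n → ℝ)) :=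
    Matrix.toLinAlgEquiv'.trans
      (Module.End.toContinuousLinearMap (Fin n → ℝ))
  have hΦ : ∀ A y, Φ A y = A.mulVec y := fun A y => rfl
  have hT := fun i => contDiffOn_and_pd_of_matrix Φ.toLinearMap hU (hm i)
  obtain ⟨P, hP0, hP⟩ := exists_fundamental_solution hU hsc
    (T := fun i x => Φ (Matrix.of fun p q => m i p q x)) (fun i => (hT i).1)
    (fun i k x hx => by
      have e : (Matrix.of fun p q => pd k (m i p q) x)
            + (Matrix.of fun p q => m i p q x) * (Matrix.of fun p q => m k p q x)
          = (Matrix.of fun p q => pd i (m k p q) x)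
            + (Matrix.of fun p q => m k p q x) * (Matrix.of fun p q => m i p q x) := by
        ext p q
        simpa [Matrix.mul_apply] using hint i k p q x hx
      have h1 := (hT i).2 k x hx
      have h2 := (hT k).2 i x hx
      simp only [AlgEquiv.toLinearMap_apply] at h1 h2
      rw [h1, h2, ← map_mul Φ, ← map_mul Φ, ← map_add Φ, ← map_add Φ, e]) hx₀
  have hyd : ∀ p, ∀ x ∈ U, DifferentiableAt ℝ (fun x => P x y₀ p) x := fun p x hx =>
    (ContinuousLinearMap.proj (R := ℝ) (φ := fun _ : Fin n => ℝ) p).differentiableAt.comp x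
      ((hP x hx).1.clm_apply (differentiableAt_const y₀))
  have hpd : ∀ i p, ∀ x ∈ U, pd i (fun x => P x y₀ p) x = ∑ q, m i p q x * P x y₀ q := by
    intro i p x hx
    have h1 := (hP x hx).1.hasFDerivAt.clm_apply (hasFDerivAt_const y₀ x)
    have h2 := (ContinuousLinearMap.proj (R := ℝ) (φ := fun _ : Fin n => ℝ) p).hasFDerivAt.comp x h1
    have h3 : pd i (fun x => P x y₀ p) x = pd i P x y₀ p := by
      unfold pd
      refine (congrFun (congrArg DFunLike.coe h2.fderiv) _).trans ?_
      simp
    rw [h3, (hP x hx).2 i]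
    simp [hΦ, Matrix.mulVec, dotProduct]
  exact ⟨fun p x => P x y₀ p, fun p => by simp [hP0],
    contDiffOn_of_linear_system hU hm hyd hpd, hpd⟩

end LinearSystems

/-! ### The second fundamental form of the flat immersion as a cross product. -/

section ConjugatePair

variable {U : Set E3} {x : E3}

theorem deltaSign_mul_self (e C : ℝ) (i : Fin 3) : deltaSign e C i * deltaSign e C i = 1 := by
  unfold deltaSign
  split_ifs <;> fin_cases i <;> simp

/-- The only property shared by the two sign patterns that the cross product needs: it gives `δ_i
δ_j = -δ_k` for distinct indices, so no case distinction on `ε̂` and `C` occurs later. -/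
theorem deltaSign_prod (e C : ℝ) : deltaSign e C 0 * deltaSign e C 1 * deltaSign e C 2 = -1 := by
  unfold deltaSign
  split_ifs <;> simp

/-- The third member of the orthogonal frame that a pair `(v, V)` with the algebraic conditions
spans: the cross product of `v` and `V`, with the index lowered by the signs `δ`. It is the second
fundamental form of the hypersurface of the flat space. -/
def crossPair (δ : Fin 3 → ℝ) (v W : Fin 3 → E3 → ℝ) (i : Fin 3) (x : E3) : ℝ :=
  δ i * (v (i + 1) x * W (i + 2) x - v (i + 2) x * W (i + 1) x)

theorem contDiffOn_crossPair {δ : Fin 3 → ℝ} {v W : Fin 3 → E3 → ℝ}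
    (hv : ∀ i, ContDiffOn ℝ ∞ (v i) U) (hW : ∀ i, ContDiffOn ℝ ∞ (W i) U) (i : Fin 3) :
    ContDiffOn ℝ ∞ (crossPair δ v W i) U :=
  contDiffOn_const.mul (((hv _).mul (hW _)).sub ((hv _).mul (hW _)))

/-- `v`, `V` and their cross product are orthogonal for `diag δ`, and this is the off-diagonal part
of the expansion of `diag δ` in that frame. As a polynomial identity: insert the sums for `C` and
`e` and subtract `v_i V_j + v_j V_i` times the vanishing mixed sum. It turns the Gauss equation of
the space form into that of flat space. -/
theorem crossPair_mul_crossPair {δ : Fin 3 → ℝ} (hδ : ∀ i, δ i * δ i = 1)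
    (hδ3 : δ 0 * δ 1 * δ 2 = -1) {v W : Fin 3 → E3 → ℝ} {e C : ℝ}
    (h1 : ∑ i, δ i * v i x ^ 2 = e) (h2 : ∑ i, δ i * (v i x * W i x) = 0)
    (h3 : ∑ i, δ i * W i x ^ 2 = C) {i j : Fin 3} (hij : i ≠ j) :
    crossPair δ v W i x * crossPair δ v W j x
      = C * (v i x * v j x) + e * (W i x * W j x) := by
  have d01 : δ 0 * δ 1 = -δ 2 := by
    linear_combination δ 2 * hδ3 - δ 0 * δ 1 * hδ 2
  have d02 : δ 0 * δ 2 = -δ 1 := by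
    linear_combination δ 1 * hδ3 - δ 0 * δ 2 * hδ 1
  have d12 : δ 1 * δ 2 = -δ 0 := by
    linear_combination δ 0 * hδ3 - δ 1 * δ 2 * hδ 0
  simp only [Fin.sum_univ_three] at h1 h2 h3
  have s01 : crossPair δ v W 0 x * crossPair δ v W 1 x
      = C * (v 0 x * v 1 x) + e * (W 0 x * W 1 x) := by
    simp only [crossPair, Fin.isValue, Fin.reduceAdd, zero_add]
    rw [← h1, ← h3]
    linear_combination (v 1 x * W 2 x - v 2 x * W 1 x) * (v 2 x * W 0 x - v 0 x * W 2 x) * d01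
      - (v 0 x * W 1 x + v 1 x * W 0 x) * h2
  have s02 : crossPair δ v W 0 x * crossPair δ v W 2 x
      = C * (v 0 x * v 2 x) + e * (W 0 x * W 2 x) := by
    simp only [crossPair, Fin.isValue, Fin.reduceAdd, zero_add]
    rw [← h1, ← h3]
    linear_combination (v 1 x * W 2 x - v 2 x * W 1 x) * (v 0 x * W 1 x - v 1 x * W 0 x) * d02
      - (v 0 x * W 2 x + v 2 x * W 0 x) * h2
  have s12 : crossPair δ v W 1 x * crossPair δ v W 2 x
      = C * (v 1 x * v 2 x) + e * (W 1 x * W 2 x) := by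
    simp only [crossPair, Fin.isValue, Fin.reduceAdd]
    rw [← h1, ← h3]
    linear_combination (v 2 x * W 0 x - v 0 x * W 2 x) * (v 0 x * W 1 x - v 1 x * W 0 x) * d12
      - (v 1 x * W 2 x + v 2 x * W 1 x) * h2
  fin_cases i <;> fin_cases j <;> simp only [Fin.zero_eta, Fin.mk_one, Fin.reduceFinMk, ne_eq,
    not_true_eq_false] at hij ⊢
  · exact s01
  · exact s02
  · linear_combination s01
  · exact s12
  · linear_combination s02
  · linear_combination s12

/-- This is the Codazzi equation for `w`. The equations for `∂_i v_k` and `∂_i V_k` cover `k ≠ i`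
only; the missing `∂_i v_i` and `∂_i V_i` come from differentiating the constant sums `∑ δ v²` and
`∑ δ v V`. -/
theorem pd_crossPair (hU : IsOpen U) {δ : Fin 3 → ℝ} (hδ : ∀ i, δ i * δ i = 1)
    {v W : Fin 3 → E3 → ℝ} {e : ℝ}
    (hv : ∀ i, ContDiffOn ℝ ∞ (v i) U) (hW : ∀ i, ContDiffOn ℝ ∞ (W i) U)
    (hv0 : ∀ i, ∀ y ∈ U, v i y ≠ 0)
    (h1 : ∀ y ∈ U, ∑ i, δ i * v i y ^ 2 = e) (h2 : ∀ y ∈ U, ∑ i, δ i * (v i y * W i y) = 0)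
    (hcod : ∀ i j, i ≠ j → ∀ y ∈ U, pd i (W j) y = rot v i j y * W i y)
    (hx : x ∈ U) {i j : Fin 3} (hij : i ≠ j) :
    pd i (crossPair δ v W j) x = rot v i j x * crossPair δ v W i x := by
  have dv : ∀ i, DifferentiableAt ℝ (v i) x := fun i => differentiableAt_of_contDiffOn hU (hv i) hx
  have dW : ∀ i, DifferentiableAt ℝ (W i) x := fun i => differentiableAt_of_contDiffOn hU (hW i) hx
  have hp : pd i (crossPair δ v W j) x = δ j *
      (pd i (v (j + 1)) x * W (j + 2) x + v (j + 1) x * pd i (W (j + 2)) x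
        - (pd i (v (j + 2)) x * W (j + 1) x + v (j + 2) x * pd i (W (j + 1)) x)) := by
    unfold crossPair
    rw [pd_const_mul _ (((dv _).fun_mul (dW _)).fun_sub ((dv _).fun_mul (dW _))),
      pd_sub ((dv _).fun_mul (dW _)) ((dv _).fun_mul (dW _)), pd_mul (dv _) (dW _),
      pd_mul (dv _) (dW _)]
  have d1 : ∑ k, δ k * (v k x * pd i (v k) x) = 0 := by
    have h := pd_eq_zero_of_const hU h1 hx i
    simp only [Fin.sum_univ_three, pow_two] at h
    have m : ∀ k, DifferentiableAt ℝ (fun y => v k y * v k y) x := fun k => (dv k).fun_mul (dv k)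
    rw [pd_add (((m 0).const_mul _).fun_add ((m 1).const_mul _)) ((m 2).const_mul _),
      pd_add ((m 0).const_mul _) ((m 1).const_mul _), pd_const_mul _ (m 0), pd_const_mul _ (m 1),
      pd_const_mul _ (m 2), pd_mul (dv _) (dv _), pd_mul (dv _) (dv _), pd_mul (dv _) (dv _)] at h
    simp only [Fin.sum_univ_three]
    linarith
  have d2 : ∑ k, δ k * (pd i (v k) x * W k x + v k x * pd i (W k) x) = 0 := by
    have h := pd_eq_zero_of_const hU h2 hx i
    simp only [Fin.sum_univ_three] at h
    have m : ∀ k, DifferentiableAt ℝ (fun y => v k y * W k y) x := fun k => (dv k).fun_mul (dW k)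
    rw [pd_add (((m 0).const_mul _).fun_add ((m 1).const_mul _)) ((m 2).const_mul _),
      pd_add ((m 0).const_mul _) ((m 1).const_mul _), pd_const_mul _ (m 0), pd_const_mul _ (m 1),
      pd_const_mul _ (m 2), pd_mul (dv _) (dW _), pd_mul (dv _) (dW _), pd_mul (dv _) (dW _)] at h
    simp only [Fin.sum_univ_three]
    linarith
  have hr : ∀ k, pd i (v k) x = rot v i k x * v i x := fun k => by
    unfold rot
    field_simp [hv0 i x hx]
  have hc := fun k (hk : i ≠ k) => hcod i k hk x hx
  -- In `∂_i w_j` the two terms `h_ik v_i V_i` cancel, so only the diagonal derivatives remain, and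
  -- `e1`, `e2` supply these. Both cyclic orders of `i`, `j` are instances of this formula up to
  -- sign.
  have main : ∀ j k, i ≠ j → i ≠ k → j ≠ k →
      δ j * (v k x * pd i (W i) x - pd i (v i) x * W k x)
        = rot v i j x * (δ i * (v j x * W k x - v k x * W j x)) := by
    intro j k hij hik hjk
    have hu : (Finset.univ : Finset (Fin 3)) = {i, j, k} := by
      clear * - hij hik hjk
      revert i j k; decide
    rw [hu, Finset.sum_insert (by simp [hij, hik]), Finset.sum_insert (by simp [hjk]),
      Finset.sum_singleton] at d1 d2
    have e1 : δ i * pd i (v i) x + δ j * (v j x * rot v i j x) + δ k * (v k x * rot v i k x) = 0 :=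
      mul_left_cancel₀ (hv0 i x hx) (by
        linear_combination d1 - δ j * v j x * hr j - δ k * v k x * hr k)
    have e2 : δ i * pd i (W i) x + δ j * (rot v i j x * W j x) + δ k * (rot v i k x * W k x) = 0 :=
      mul_left_cancel₀ (hv0 i x hx) (by
        linear_combination d2 - W i x * e1 - δ j * W j x * hr j - δ k * W k x * hr k
          - δ j * v j x * hc j hij - δ k * v k x * hc k hik)
    linear_combination (δ i * δ j) * (v k x * e2 - W k x * e1)
      - δ j * (v k x * pd i (W i) x - pd i (v i) x * W k x) * hδ i
      - δ i * rot v i j x * (v k x * W j x - v j x * W k x) * hδ j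
  rw [hp]
  unfold crossPair
  have hne1 : i ≠ i + 1 := by clear * -; revert i; decide
  have hne2 : i ≠ i + 2 := by clear * -; revert i; decide
  have hne3 : i + 1 ≠ i + 2 := by clear * -; revert i; decide
  have hcases : (j = i + 1 ∧ j + 1 = i + 2 ∧ j + 2 = i) ∨ (j = i + 2 ∧ j + 1 = i ∧ j + 2 = i + 1) := by
    clear * - hij
    revert i j; decide
  rcases hcases with ⟨a, b, c⟩ | ⟨a, b, c⟩
  · rw [b, c, hr (i + 2), hc (i + 2) hne2, a]
    linear_combination main (i + 1) (i + 2) hne1 hne2 hne3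
  · rw [b, c, hr (i + 1), hc (i + 1) hne1, a]
    linear_combination -main (i + 2) (i + 1) hne2 hne1 hne3.symm

end ConjugatePair

/-! ### Integration of the Gauss-Codazzi system in flat space. -/

section FlatImmersion

variable {U : Set E3}

/-- The coefficients of the linear system of the frame `(ξ, X₁, X₂, X₃)` and the position vector `g`
of a holonomic hypersurface of a flat space whose unit normal has square `η`. -/
def frameCoeff (η : ℝ) (h : Fin 3 → Fin 3 → E3 → ℝ) (v w : Fin 3 → E3 → ℝ) :
    Fin 3 → Fin 5 → Fin 5 → E3 → ℝ :=
  ![![![0, -w 0, 0, 0, 0], ![η • w 0, 0, -h 1 0, -h 2 0, 0], ![0, h 1 0, 0, 0, 0],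
      ![0, h 2 0, 0, 0, 0], ![0, v 0, 0, 0, 0]],
    ![![0, 0, -w 1, 0, 0], ![0, 0, h 0 1, 0, 0], ![η • w 1, -h 0 1, 0, -h 2 1, 0],
      ![0, 0, h 2 1, 0, 0], ![0, 0, v 1, 0, 0]],
    ![![0, 0, 0, -w 2, 0], ![0, 0, 0, h 0 2, 0], ![0, 0, 0, h 1 2, 0],
      ![η • w 2, -h 0 2, -h 1 2, 0, 0], ![0, 0, 0, v 2, 0]]]

theorem contDiffOn_frameCoeff {η : ℝ} {h : Fin 3 → Fin 3 → E3 → ℝ} {v w : Fin 3 → E3 → ℝ}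
    (hh : ∀ i j, ContDiffOn ℝ ∞ (h i j) U) (hv : ∀ i, ContDiffOn ℝ ∞ (v i) U)
    (hw : ∀ i, ContDiffOn ℝ ∞ (w i) U) (i : Fin 3) (p q : Fin 5) :
    ContDiffOn ℝ ∞ (frameCoeff η h v w i p q) U := by
  have h0 : ContDiffOn ℝ ∞ (0 : E3 → ℝ) U := contDiffOn_const
  have hη : ∀ i, ContDiffOn ℝ ∞ (η • w i) U := fun i => contDiffOn_const.smul (hw i)
  fin_cases i <;> fin_cases p <;> fin_cases q <;>
    first
      | exact h0
      | exact hη _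
      | exact hv _
      | exact (hw _).neg
      | exact hh _ _
      | exact (hh _ _).neg

/-- Entry by entry, integrability of the frame system is Codazzi in the entries that couple `ξ` to
the `X_i`, Darboux and Gauss among the `X_i`, and `∂_i v_j = h_ij v_i` in the row of `g`. -/
theorem pd_frameCoeff_symm {η : ℝ} {h : Fin 3 → Fin 3 → E3 → ℝ}
    {v w : Fin 3 → E3 → ℝ}
    (hpv : ∀ i j, i ≠ j → ∀ x ∈ U, pd i (v j) x = h i j x * v i x)
    (hpw : ∀ i j, i ≠ j → ∀ x ∈ U, pd i (w j) x = h i j x * w i x)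
    (hdar : ∀ i j k, i ≠ j → i ≠ k → j ≠ k → ∀ x ∈ U, pd k (h j i) x = h j k x * h k i x)
    (hgauss : ∀ i j k, i ≠ j → i ≠ k → j ≠ k → ∀ x ∈ U, pd i (h i j) x + pd j (h j i) x
      + h k i x * h k j x + η * (w i x * w j x) = 0)
    (i k : Fin 3) (p q : Fin 5) {x : E3} (hx : x ∈ U) :
    pd k (frameCoeff η h v w i p q) x
        + ∑ r, frameCoeff η h v w i p r x * frameCoeff η h v w k r q x
      = pd i (frameCoeff η h v w k p q) x
        + ∑ r, frameCoeff η h v w k p r x * frameCoeff η h v w i r q x := by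
  have z : ∀ i, pd i (0 : E3 → ℝ) x = 0 := fun i => pd_const 0 i
  have ng : ∀ (a : E3 → ℝ) i, pd i (-a) x = -pd i a x := fun a i => pd_neg a i
  have sm : ∀ (a : E3 → ℝ) i, pd i (η • a) x = η * pd i a x := fun a i => by
    unfold pd
    rw [fderiv_const_smul_field]
    simp
  have w01 := hpw 0 1 (by decide) x hx
  have w02 := hpw 0 2 (by decide) x hx
  have w10 := hpw 1 0 (by decide) x hx
  have w12 := hpw 1 2 (by decide) x hx
  have w20 := hpw 2 0 (by decide) x hx
  have w21 := hpw 2 1 (by decide) x hx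
  have v01 := hpv 0 1 (by decide) x hx
  have v02 := hpv 0 2 (by decide) x hx
  have v10 := hpv 1 0 (by decide) x hx
  have v12 := hpv 1 2 (by decide) x hx
  have v20 := hpv 2 0 (by decide) x hx
  have v21 := hpv 2 1 (by decide) x hx
  have d012 := hdar 0 1 2 (by decide) (by decide) (by decide) x hx
  have d021 := hdar 0 2 1 (by decide) (by decide) (by decide) x hx
  have d102 := hdar 1 0 2 (by decide) (by decide) (by decide) x hx
  have d120 := hdar 1 2 0 (by decide) (by decide) (by decide) x hx
  have d201 := hdar 2 0 1 (by decide) (by decide) (by decide) x hx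
  have d210 := hdar 2 1 0 (by decide) (by decide) (by decide) x hx
  have g01 := hgauss 0 1 2 (by decide) (by decide) (by decide) x hx
  have g02 := hgauss 0 2 1 (by decide) (by decide) (by decide) x hx
  have g12 := hgauss 1 2 0 (by decide) (by decide) (by decide) x hx
  have key : ∀ i k : Fin 3, i < k → ∀ p q, pd k (frameCoeff η h v w i p q) x
        + ∑ r, frameCoeff η h v w i p r x * frameCoeff η h v w k r q x
      = pd i (frameCoeff η h v w k p q) x
        + ∑ r, frameCoeff η h v w k p r x * frameCoeff η h v w i r q x := by
    intro i k hik p q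
    simp only [Fin.sum_univ_five]
    fin_cases i <;> fin_cases k <;> first
      | exact absurd hik (by decide)
      | (fin_cases p <;> fin_cases q <;> simp [frameCoeff, z, ng, sm, w01, w02, w10, w12, w20, w21,
          v01, v02, v10, v12, v20, v21, d012, d021, d102, d120, d201, d210] <;> linarith)
  rcases lt_trichotomy i k with hik | hik | hik
  · exact key i k hik p q
  · rw [hik]
  · exact (key k i hik p q).symm

/-- `Yᵀ J Y = J` implies `Y J Yᵀ = J`, since a left inverse of a square matrix is a right inverse.
The system conserves products between its solutions, one for each target coordinate; the induced
metric needs products between frame vectors. -/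
theorem pseudo_transpose_mul {s' : ℕ} {Y : Matrix (Fin 4) (Fin 4) ℝ}
    (hY : ∀ a b, ∑ p : Fin 4, (if (p : ℕ) < s' then (-1 : ℝ) else 1) * (Y p a * Y p b)
      = if a = b then (if (a : ℕ) < s' then (-1 : ℝ) else 1) else 0) (p q : Fin 4) :
    pseudoInner s' (Y p) (Y q) = if p = q then (if (p : ℕ) < s' then (-1 : ℝ) else 1) else 0 := by
  set J : Matrix (Fin 4) (Fin 4) ℝ :=
    Matrix.diagonal fun a => if (a : ℕ) < s' then (-1 : ℝ) else 1 with hJ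
  have hJJ : J * J = 1 := by
    rw [hJ, Matrix.diagonal_mul_diagonal, ← Matrix.diagonal_one]
    congr 1
    funext a
    split_ifs <;> norm_num
  have h1 : Y.transpose * J * Y = J := by
    ext a b
    rw [Matrix.mul_apply, hJ]
    simp only [Matrix.mul_diagonal, Matrix.transpose_apply, Matrix.diagonal_apply]
    rw [← hY a b]
    exact Finset.sum_congr rfl fun p _ => by ring
  have h2 : (J * Y.transpose * J) * Y = 1 := by
    rw [Matrix.mul_assoc, Matrix.mul_assoc, ← Matrix.mul_assoc Y.transpose, h1, hJJ]
  have h3 : Y * J * Y.transpose = J := by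
    have h4 := mul_eq_one_comm.1 h2
    calc Y * J * Y.transpose = Y * (J * Y.transpose * J) * J := by
          simp only [Matrix.mul_assoc, hJJ, Matrix.mul_one]
      _ = J := by rw [h4, Matrix.one_mul]
  have h5 := congrFun (congrFun h3 p) q
  rw [Matrix.mul_apply, hJ] at h5
  simp only [Matrix.mul_diagonal, Matrix.transpose_apply, Matrix.diagonal_apply] at h5
  rw [← h5]
  exact Finset.sum_congr rfl fun a _ => by ring

/-- The fundamental theorem of holonomic hypersurfaces of a flat space: the Gauss and Codazzi
equations imply the existence of an immersion with the given metric. -/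
theorem exists_flat_immersion (hU : IsOpen U) (hsc : IsSimplyConnected U) {s' : ℕ}
    (hs' : s' = 0 ∨ s' = 1) {h : Fin 3 → Fin 3 → E3 → ℝ} {v w : Fin 3 → E3 → ℝ}
    (hh : ∀ i j, ContDiffOn ℝ ∞ (h i j) U) (hv : ∀ i, ContDiffOn ℝ ∞ (v i) U)
    (hw : ∀ i, ContDiffOn ℝ ∞ (w i) U)
    (hpv : ∀ i j, i ≠ j → ∀ x ∈ U, pd i (v j) x = h i j x * v i x)
    (hpw : ∀ i j, i ≠ j → ∀ x ∈ U, pd i (w j) x = h i j x * w i x)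
    (hdar : ∀ i j k, i ≠ j → i ≠ k → j ≠ k → ∀ x ∈ U, pd k (h j i) x = h j k x * h k i x)
    (hgauss : ∀ i j k, i ≠ j → i ≠ k → j ≠ k → ∀ x ∈ U, pd i (h i j) x + pd j (h j i) x
      + h k i x * h k j x + indexSign s' * (w i x * w j x) = 0) :
    ∃ G : Fin 4 → E3 → ℝ, (∀ a, ContDiffOn ℝ ∞ (G a) U) ∧ ∀ i j, ∀ x ∈ U,
      pseudoInner s' (fun a => pd i (G a) x) (fun a => pd j (G a) x)
        = if i = j then v i x * v i x else 0 := by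
  obtain ⟨x₀, hx₀⟩ := hsc.nonempty
  -- Each target coordinate `a` solves the same scalar system for the `a`-th components of `(ξ, X₁,
  -- X₂, X₃, g)`. The initial frame is the standard basis, with `ξ` on coordinate 0, the time-like
  -- one if `s' = 1`, and `g = 0` at `x₀`.
  have hex := fun a : Fin 4 => exists_solution_of_integrable hU hsc
    (contDiffOn_frameCoeff (η := indexSign s') hh hv hw)
    (fun i k p q x hx => pd_frameCoeff_symm hpv hpw hdar hgauss i k p q hx) hx₀
    (Pi.single a.castSucc 1)
  choose y hy0 hys hyd using hex
  have sgn : ∀ p : Fin 4, (if (p : ℕ) < s' then (-1 : ℝ) else 1)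
      = ![indexSign s', 1, 1, 1] p := fun p => by
    rcases hs' with rfl | rfl <;> fin_cases p <;> norm_num [indexSign]
  have hconst : ∀ a b, ∀ x ∈ U,
      ∑ p : Fin 4, (if (p : ℕ) < s' then (-1 : ℝ) else 1)
        * (y a p.castSucc x * y b p.castSucc x)
      = if a = b then (if (a : ℕ) < s' then (-1 : ℝ) else 1) else 0 := by
    intro a b x hx
    have hd : ∀ a p, ∀ x ∈ U, DifferentiableAt ℝ (y a p) x := fun a p x hx =>
      differentiableAt_of_contDiffOn hU (hys a p) hx
    set φ : E3 → ℝ := fun x => ∑ p : Fin 4, (if (p : ℕ) < s' then (-1 : ℝ) else 1)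
        * (y a p.castSucc x * y b p.castSucc x) with hφ
    have hφd : ∀ x ∈ U, HasFDerivAt φ (∑ p : Fin 4, (if (p : ℕ) < s' then (-1 : ℝ) else 1) •
        (y a p.castSucc x • fderiv ℝ (y b p.castSucc) x
          + y b p.castSucc x • fderiv ℝ (y a p.castSucc) x)) x := fun x hx =>
      HasFDerivAt.fun_sum fun p _ =>
        ((hd a _ x hx).hasFDerivAt.fun_mul (hd b _ x hx).hasFDerivAt).const_mul _
    -- The frame block of the coefficient matrix is skew for the form `diag(η, 1, 1, 1)`, so the
    -- form is constant along solutions.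
    have hz : Set.EqOn (fderiv ℝ φ) 0 U := by
      intro x hx
      have hpd : ∀ i, pd i φ x = 0 := fun i => by
        have e : pd i φ x = ∑ p : Fin 4, (if (p : ℕ) < s' then (-1 : ℝ) else 1) *
            (y a p.castSucc x * pd i (y b p.castSucc) x
              + y b p.castSucc x * pd i (y a p.castSucc) x) := by
          unfold pd
          rw [(hφd x hx).fderiv]
          simp only [sum_apply, smul_apply, add_apply, smul_eq_mul]
        rw [e]
        simp only [sgn, hyd _ i _ x hx, Fin.sum_univ_four, Fin.sum_univ_five]
        fin_cases i <;> simp [frameCoeff] <;> ring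
      ext c
      rw [fderiv_apply_eq_sum_pd]
      simp [hpd]
    have hc := hU.is_const_of_fderiv_eq_zero hsc.isPathConnected.isConnected.isPreconnected
      (fun x hx => (hφd x hx).differentiableAt.differentiableWithinAt) hz hx hx₀
    change φ x = _
    rw [hc, hφ]
    simp only [hy0, Pi.single_apply, Fin.castSucc_inj]
    by_cases hab : a = b
    · subst hab
      simp
    · simp [hab, Ne.symm hab]
  refine ⟨fun a => y a (Fin.last 4), fun a => hys a _, fun i j x hx => ?_⟩
  have hG : ∀ i a, pd i (y a (Fin.last 4)) x = v i x * y a (i.succ.castSucc) x := fun i a => by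
    rw [hyd a i _ x hx, Fin.sum_univ_five]
    fin_cases i <;> simp [frameCoeff, Fin.last]
  have horth := pseudo_transpose_mul (Y := fun p a => y a p.castSucc x)
    (fun a b => hconst a b x hx) i.succ j.succ
  have e : pseudoInner s' (fun a => pd i (y a (Fin.last 4)) x)
      (fun a => pd j (y a (Fin.last 4)) x) = v i x * v j x *
        pseudoInner s' (fun a => y a i.succ.castSucc x) (fun a => y a j.succ.castSucc x) := by
    simp only [hG, pseudoInner, Finset.mul_sum]
    exact Finset.sum_congr rfl fun a _ => by ring
  rw [e, horth, sgn]
  by_cases hij : i = j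
  · subst hij
    fin_cases i <;> simp
  · simp [hij]

end FlatImmersion

/-! ### The ambient inner product as a nondegenerate bilinear form. -/

section AmbientForm

/-- The inner product of the pseudo-Euclidean space `ℝ⁵` as a continuous bilinear form. -/
def ambientForm (s : ℕ) (c : ℝ) : (Fin 5 → ℝ) →L[ℝ] (Fin 5 → ℝ) →L[ℝ] ℝ :=
  ∑ i : Fin 5, (if (i : ℕ) < ambientIndex s c then (-1 : ℝ) else 1) •
    (ContinuousLinearMap.proj (R := ℝ) (φ := fun _ : Fin 5 => ℝ) i).smulRight
      (ContinuousLinearMap.proj (R := ℝ) (φ := fun _ : Fin 5 => ℝ) i)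

theorem ambientForm_apply (s : ℕ) (c : ℝ) (x y : Fin 5 → ℝ) :
    ambientForm s c x y = ambientInner s c x y := by
  simp only [ambientForm, ambientInner, pseudoInner, sum_apply, smul_apply, smul_eq_mul,
    ContinuousLinearMap.smulRight_apply, ContinuousLinearMap.proj_apply]

theorem ambientForm_symm (s : ℕ) (c : ℝ) (x y : Fin 5 → ℝ) :
    ambientForm s c x y = ambientForm s c y x := by
  simp only [ambientForm_apply, ambientInner, pseudoInner, mul_comm]

/-- A vector of `ℝ⁵` that is orthogonal to five pairwise orthogonal vectors, none of which is
light-like, vanishes. -/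
theorem eq_zero_of_orthogonal {s : ℕ} {c : ℝ} {b : Fin 5 → Fin 5 → ℝ}
    (hb : ∀ i j, i ≠ j → ambientForm s c (b i) (b j) = 0)
    (hb0 : ∀ i, ambientForm s c (b i) (b i) ≠ 0) {z : Fin 5 → ℝ}
    (hz : ∀ i, ambientForm s c z (b i) = 0) : z = 0 := by
  have hli : LinearIndependent ℝ b := by
    rw [Fintype.linearIndependent_iff]
    intro g hg i
    have h := congrArg (fun y => ambientForm s c y (b i)) hg
    simp only [map_sum, map_smul, sum_apply, smul_apply, map_zero, zero_apply, smul_eq_mul] at h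
    rw [Finset.sum_eq_single i (fun j _ hj => by rw [hb j i hj, mul_zero])
      (fun hi => absurd (Finset.mem_univ i) hi)] at h
    exact (mul_eq_zero.1 h).resolve_right (hb0 i)
  have hspan := hli.span_eq_top_of_card_eq_finrank (by simp)
  have hzero : (ambientForm s c z : (Fin 5 → ℝ) →ₗ[ℝ] ℝ) = 0 := by
    refine LinearMap.ext_on hspan ?_
    rintro _ ⟨i, rfl⟩
    simpa using hz i
  funext i
  have h := LinearMap.congr_fun hzero (Pi.single i 1)
  rw [ContinuousLinearMap.coe_coe, ambientForm_apply, ambientInner, pseudoInner,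
    Finset.sum_eq_single i (fun j _ hj => by simp [hj]) (fun hi => absurd (Finset.mem_univ i) hi)]
    at h
  simp only [Pi.single_eq_same, mul_one, LinearMap.zero_apply] at h
  refine (mul_eq_zero.1 h).resolve_left ?_
  split_ifs <;> norm_num

end AmbientForm

/-! ### Transfer between the manifold and its global chart. -/

section GlobalCoordinates

variable {M : Type*} [TopologicalSpace M] [ChartedSpace (EuclideanSpace ℝ (Fin 3)) M]
  {u : OpenPartialHomeomorph M (EuclideanSpace ℝ (Fin 3))}

namespace IsGlobalCoord

theorem mem_source (hu : IsGlobalCoord u) (x : M) : x ∈ u.source := by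
  rw [hu.1]; trivial

theorem mdifferentiable (hu : IsGlobalCoord u) : u.MDifferentiable (𝓡 3) (𝓡 3) :=
  ⟨(contMDiffOn_of_mem_maximalAtlas hu.2).mdifferentiableOn (by simp),
    (contMDiffOn_symm_of_mem_maximalAtlas hu.2).mdifferentiableOn (by simp)⟩

/-- `ContinuousLinearMap.inverse` is 0 on non-invertible maps. Here the differentials of `u` and
`u.symm` are two-sided inverses, so the default value does not occur. -/
theorem coordField_eq (hu : IsGlobalCoord u) (j : Fin 3) (x : M) :
    coordField u j x = mfderiv (𝓡 3) (𝓡 3) u.symm (u x) (EuclideanSpace.single j (1 : ℝ) : E3) := by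
  unfold coordField
  have h1 := hu.mdifferentiable.symm_comp_deriv (hu.mem_source x)
  have h2 := hu.mdifferentiable.comp_symm_deriv (u.map_source (hu.mem_source x))
  rw [u.left_inv (hu.mem_source x)] at h2
  rw [ContinuousLinearMap.inverse_eq h2 h1]
  rfl

theorem mfderiv_coordField (hu : IsGlobalCoord u) (j : Fin 3) (x : M) :
    mfderiv (𝓡 3) (𝓡 3) u x (coordField u j x) = (EuclideanSpace.single j (1 : ℝ) : E3) := by
  rw [hu.coordField_eq]
  have h2 := hu.mdifferentiable.comp_symm_deriv (u.map_source (hu.mem_source x))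
  rw [u.left_inv (hu.mem_source x)] at h2
  exact DFunLike.congr_fun h2 _

theorem coordField_ne_zero (hu : IsGlobalCoord u) (j : Fin 3) (x : M) : coordField u j x ≠ 0 := by
  intro h
  have h1 := hu.mfderiv_coordField j x
  rw [h, map_zero] at h1
  have h2 : (0 : E3) j = (EuclideanSpace.single j (1 : ℝ) : E3) j := congrArg (fun e : E3 => e j) h1
  simp at h2

theorem eq_sum_coordField (hu : IsGlobalCoord u) (x : M) (X : TangentSpace (𝓡 3) x) :
    ∃ a : Fin 3 → ℝ, X = ∑ j, a j • coordField u j x := by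
  obtain ⟨a, ha⟩ : ∃ a : Fin 3 → ℝ, mfderiv (𝓡 3) (𝓡 3) u x X
        = (∑ j, a j • (EuclideanSpace.single j (1 : ℝ) : E3) : E3) := by
    obtain ⟨e, he⟩ : ∃ e : E3, mfderiv (𝓡 3) (𝓡 3) u x X = e := ⟨_, rfl⟩
    refine ⟨fun j => e j, he.trans (PiLp.ext fun j => ?_)⟩
    simp [Pi.single_apply]
  refine ⟨a, ?_⟩
  apply hu.mdifferentiable.mfderiv_injective (hu.mem_source x)
  rw [ha, map_sum]
  refine Finset.sum_congr rfl fun j _ => ?_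
  rw [map_smul, hu.mfderiv_coordField]
  rfl

theorem contDiffOn_comp_symm (hu : IsGlobalCoord u) {n : ℕ} {f : M → Fin n → ℝ}
    (hf : ContMDiff (𝓡 3) 𝓘(ℝ, Fin n → ℝ) ∞ f) : ContDiffOn ℝ ∞ (f ∘ u.symm) u.target := by
  rw [← contMDiffOn_iff_contDiffOn]
  exact hf.comp_contMDiffOn (contMDiffOn_symm_of_mem_maximalAtlas hu.2)

theorem pd_comp_symm (hu : IsGlobalCoord u) {n : ℕ} {f : M → Fin n → ℝ}
    (hf : ContMDiff (𝓡 3) 𝓘(ℝ, Fin n → ℝ) ∞ f) (j : Fin 3) (x : M) :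
    pd j (f ∘ u.symm) (u x) = dmap f x (coordField u j x) := by
  have hx := u.left_inv (hu.mem_source x)
  have h1 : MDifferentiableAt (𝓡 3) 𝓘(ℝ, Fin n → ℝ) f (u.symm (u x)) :=
    hf.mdifferentiable (by simp) _
  have h2 := hu.mdifferentiable.mdifferentiableAt_symm (u.map_source (hu.mem_source x))
  unfold pd dmap
  rw [← mfderiv_eq_fderiv, mfderiv_comp (u x) h1 h2, hu.coordField_eq, hx]
  rfl

theorem contMDiffOn_comp (hu : IsGlobalCoord u) {n : ℕ} {G : E3 → Fin n → ℝ} {W : Set M}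
    (hG : ContDiffOn ℝ ∞ G (u '' W)) : ContMDiffOn (𝓡 3) 𝓘(ℝ, Fin n → ℝ) ∞ (G ∘ u) W := by
  refine (contMDiffOn_iff_contDiffOn.2 hG).comp
    ((contMDiffOn_of_mem_maximalAtlas hu.2).mono fun x _ => hu.mem_source x) ?_
  exact Set.subset_preimage_image u W

theorem dmap_comp_coordField (hu : IsGlobalCoord u) {n : ℕ} {G : E3 → Fin n → ℝ} {x : M}
    (hG : DifferentiableAt ℝ G (u x)) (j : Fin 3) :
    dmap (G ∘ u) x (coordField u j x) = pd j G (u x) := by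
  unfold pd dmap
  rw [mfderiv_comp x hG.mdifferentiableAt (hu.mdifferentiable.mdifferentiableAt (hu.mem_source x)),
    mfderiv_eq_fderiv]
  change fderiv ℝ G (u x) (mfderiv (𝓡 3) (𝓡 3) u x (coordField u j x)) = _
  rw [hu.mfderiv_coordField]

theorem isOpen_image (hu : IsGlobalCoord u) {W : Set M} (hW : IsOpen W) : IsOpen (u '' W) :=
  u.isOpen_image_of_subset_source hW fun x _ => hu.mem_source x

theorem image_subset_target (hu : IsGlobalCoord u) (W : Set M) : u '' W ⊆ u.target := by
  rintro _ ⟨x, -, rfl⟩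
  exact u.map_source (hu.mem_source x)

theorem isSimplyConnected_image (hu : IsGlobalCoord u) {W : Set M} (hW : IsSimplyConnected W) :
    IsSimplyConnected (u '' W) :=
  (u.isOpenEmbedding hu.1).isEmbedding.isSimplyConnected_image.2 hW

end IsGlobalCoord

end GlobalCoordinates

/-! ### From a holonomic hypersurface to its principal frame and to the flat immersion. -/

variable {M : Type*} [TopologicalSpace M] [ChartedSpace (EuclideanSpace ℝ (Fin 3)) M]
  {u : OpenPartialHomeomorph M (EuclideanSpace ℝ (Fin 3))} {s s' : ℕ} {c : ℝ}
  {f N : M → Fin 5 → ℝ} {v V : Fin 3 → M → ℝ}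

theorem indexSign_mul_self (hs : s = 0 ∨ s = 1) : indexSign s * indexSign s = 1 := by
  rcases hs with rfl | rfl <;> norm_num [indexSign]

theorem IsHolonomicWithPair.norm_sq (hf : IsHypersurface s c f)
    (h : IsHolonomicWithPair s c f N u v V) (j : Fin 3) (x : M) :
    0 < v j x ∧ ambientInner s c (dmap f x (coordField u j x)) (dmap f x (coordField u j x))
      = v j x * v j x := by
  have hp := hf.spacelike x _ (h.coord.coordField_ne_zero j x)
  rw [h.norm j x]
  exact ⟨Real.sqrt_pos.2 hp, (Real.mul_self_sqrt hp.le).symm⟩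

theorem IsHolonomicWithPair.dmap_normal (h : IsHolonomicWithPair s c f N u v V)
    (j : Fin 3) (x : M) :
    dmap N x (coordField u j x) = -(((v j x)⁻¹ * V j x) • dmap f x (coordField u j x)) := by
  obtain ⟨A, hA, hAj⟩ := h.principal
  have h1 := hA x (coordField u j x)
  rw [hAj j x, map_smul] at h1
  rw [h1, neg_neg]

theorem eq_zero_of_orthogonal_frame {y n z : Fin 5 → ℝ} {X : Fin 3 → Fin 5 → ℝ}
    (hyy : ambientForm s c y y ≠ 0) (hnn : ambientForm s c n n ≠ 0)
    (hny : ambientForm s c n y = 0) (hXy : ∀ i, ambientForm s c (X i) y = 0)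
    (hnX : ∀ i, ambientForm s c n (X i) = 0)
    (hXX : ∀ i j, i ≠ j → ambientForm s c (X i) (X j) = 0)
    (hXX0 : ∀ i, ambientForm s c (X i) (X i) ≠ 0)
    (hzy : ambientForm s c z y = 0) (hzn : ambientForm s c z n = 0)
    (hzX : ∀ i, ambientForm s c z (X i) = 0) : z = 0 := by
  have hyn := (ambientForm_symm s c _ _).trans hny
  have hyX := fun i => (ambientForm_symm s c _ _).trans (hXy i)
  have hXn := fun i => (ambientForm_symm s c _ _).trans (hnX i)
  refine eq_zero_of_orthogonal (s := s) (c := c) (b := ![y, n, X 0, X 1, X 2]) ?_ ?_ ?_ <;>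
    generalize ambientForm s c = B at *
  · intro i j hij
    fin_cases i <;> fin_cases j <;> first
      | exact absurd rfl hij
      | exact hny
      | exact hyn
      | exact hXy _
      | exact hyX _
      | exact hnX _
      | exact hXn _
      | exact hXX _ _ (by decide)
  · intro i
    fin_cases i
    · exact hyy
    · exact hnn
    all_goals exact hXX0 _
  · intro i
    fin_cases i
    · exact hzy
    · exact hzn
    all_goals exact hzX _

/-- The coordinate expression of a holonomic hypersurface and its principal frame. -/
theorem IsHolonomicWithPair.principalFrame (hs : s = 0 ∨ s = 1) (hc : c ≠ 0)
    (hf : IsHypersurface s c f) (hN : IsUnitNormal s c f N)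
    (h : IsHolonomicWithPair s c f N u v V) :
    PrincipalFrame (ambientForm s c) c (indexSign s) u.target (f ∘ u.symm) (N ∘ u.symm)
      (fun i y => (v i (u.symm y))⁻¹ • pd i (f ∘ u.symm) y) (fun i => v i ∘ u.symm)
      (fun i => V i ∘ u.symm) := by
  have hu := h.coord
  have hU : IsOpen u.target := u.open_target
  have hF := hu.contDiffOn_comp_symm hf.smooth
  have hNs := hu.contDiffOn_comp_symm hN.smooth
  have hpt : ∀ y ∈ u.target, u (u.symm y) = y := fun y hy => u.right_inv hy
  have pdF : ∀ i, ∀ y ∈ u.target, pd i (f ∘ u.symm) y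
      = dmap f (u.symm y) (coordField u i (u.symm y)) := fun i y hy => by
    rw [← hu.pd_comp_symm hf.smooth, hpt y hy]
  have pdN : ∀ i, ∀ y ∈ u.target, pd i (N ∘ u.symm) y
      = -(((v i (u.symm y))⁻¹ * V i (u.symm y)) • pd i (f ∘ u.symm) y) := fun i y hy => by
    rw [pdF i y hy, ← h.dmap_normal i, ← hu.pd_comp_symm hN.smooth, hpt y hy]
  have hv := fun i x => (h.norm_sq hf i x).1
  have FF : ∀ i j, ∀ y ∈ u.target, ambientForm s c (pd i (f ∘ u.symm) y) (pd j (f ∘ u.symm) y)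
      = if i = j then v i (u.symm y) * v i (u.symm y) else 0 := fun i j y hy => by
    rw [pdF i y hy, pdF j y hy, ambientForm_apply]
    split_ifs with hij
    · rw [← hij]
      exact (h.norm_sq hf i _).2
    · exact h.orthogonal i j hij _
  have hB : ∀ {Y Z : E3 → Fin 5 → ℝ}, ContDiffOn ℝ ∞ Y u.target → ContDiffOn ℝ ∞ Z u.target →
      ContDiffOn ℝ ∞ (fun y => ambientForm s c (Y y) (Z y)) u.target := fun hY hZ =>
    ((ambientForm s c).contDiff.comp_contDiffOn hY).clm_apply hZ
  -- Smoothness of the pair is derived, not assumed: `v_i` is the square root of a positive smooth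
  -- function, and `V_i = -⟨∂_i N, ∂_i F⟩ / v_i`.
  have hvs : ∀ i, ContDiffOn ℝ ∞ (v i ∘ u.symm) u.target := fun i => by
    have hp := contDiffOn_pd hU hF i
    refine ((hB hp hp).sqrt fun y hy => ?_).congr fun y hy => ?_
    · rw [FF i i y hy, if_pos rfl]
      exact (mul_pos (hv i _) (hv i _)).ne'
    · rw [FF i i y hy, if_pos rfl, Real.sqrt_mul_self (hv i _).le]
      rfl
  have hVs : ∀ i, ContDiffOn ℝ ∞ (V i ∘ u.symm) u.target := fun i => by
    refine (((hB (contDiffOn_pd hU hNs i) (contDiffOn_pd hU hF i)).neg).div (hvs i)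
      fun y _ => (hv i _).ne').congr fun y hy => ?_
    have hne := (hv i (u.symm y)).ne'
    change V i (u.symm y) = -(ambientForm s c (pd i (N ∘ u.symm) y) (pd i (f ∘ u.symm) y))
      / v i (u.symm y)
    rw [pdN i y hy]
    simp only [map_neg, map_smul, neg_apply, smul_apply, FF i i y hy, if_true, smul_eq_mul]
    field_simp
  have XF : ∀ i, ∀ y ∈ u.target, ambientForm s c (pd i (f ∘ u.symm) y) ((f ∘ u.symm) y) = 0 := by
    intro i y hy
    have hd := differentiableAt_of_contDiffOn hU hF hy
    have h1 := pd_bilin (ambientForm s c) hd hd i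
    have h0 : ∀ z ∈ u.target, ambientForm s c ((f ∘ u.symm) z) ((f ∘ u.symm) z) = 1 / c :=
      fun z _ => (ambientForm_apply s c _ _).trans (hf.mem_spaceForm (u.symm z)).1
    rw [pd_eq_zero_of_const hU h0 hy,
      ambientForm_symm s c ((f ∘ u.symm) y)] at h1
    linarith
  have NX : ∀ i, ∀ y ∈ u.target, ambientForm s c ((N ∘ u.symm) y) (pd i (f ∘ u.symm) y) = 0 :=
    fun i y hy => by
      rw [pdF i y hy, ambientForm_apply]
      exact hN.normal _ _
  have hFF : ∀ y ∈ u.target, ambientForm s c ((f ∘ u.symm) y) ((f ∘ u.symm) y) = c⁻¹ :=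
    fun y _ => by
      rw [ambientForm_apply, ← one_div]
      exact (hf.mem_spaceForm _).1
  have hNN : ∀ y ∈ u.target, ambientForm s c ((N ∘ u.symm) y) ((N ∘ u.symm) y) = indexSign s :=
    fun y _ => by
      rw [ambientForm_apply]
      exact hN.unit _
  have hNF : ∀ y ∈ u.target, ambientForm s c ((N ∘ u.symm) y) ((f ∘ u.symm) y) = 0 :=
    fun y _ => by
      rw [ambientForm_apply]
      exact hN.tangent _
  refine
    { isOpen := hU
      symm := ambientForm_symm s c
      c_ne := hc
      ε_sq := indexSign_mul_self hs
      smooth_F := hF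
      smooth_N := hNs
      smooth_X := fun i => ((hvs i).inv fun y _ => (hv i _).ne').smul (contDiffOn_pd hU hF i)
      smooth_v := hvs
      smooth_W := hVs
      v_ne := fun i y _ => (hv i _).ne'
      pd_F := fun i y _ => by
        rw [smul_smul, Function.comp_apply, mul_inv_cancel₀ (hv i _).ne', one_smul]
      pd_N := fun i y hy => by
        rw [pdN i y hy, smul_smul, Function.comp_apply, mul_comm]
      X_X := fun i j y hy => ?_
      F_F := hFF
      N_N := hNN
      N_F := hNF
      X_F := fun i y hy => by
        rw [map_smul, smul_apply, XF i y hy, smul_zero]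
      X_N := fun i y hy => by
        rw [map_smul, smul_apply, ambientForm_symm, NX i y hy, smul_zero]
      nondeg := fun y hy z hzF hzN hzX => ?_ }
  · simp only [map_smul, smul_apply, FF i j y hy, smul_eq_mul]
    have h1 := (hv i (u.symm y)).ne'
    split_ifs with hij
    · subst hij
      field_simp
    · simp
  · have hzX' : ∀ i, ambientForm s c z (pd i (f ∘ u.symm) y) = 0 := fun i => by
      have h1 := hzX i
      rw [map_smul, smul_eq_mul] at h1
      exact (mul_eq_zero.1 h1).resolve_left (inv_ne_zero (hv i _).ne')
    have hε : indexSign s ≠ 0 := left_ne_zero_of_mul_eq_one (indexSign_mul_self hs)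
    exact eq_zero_of_orthogonal_frame ((hFF y hy).symm ▸ inv_ne_zero hc) ((hNN y hy).symm ▸ hε)
      (hNF y hy) (XF · y hy) (NX · y hy) (fun i j hij => (FF i j y hy).trans (if_neg hij))
      (fun i => ((FF i i y hy).trans (if_pos rfl)).symm ▸ (mul_pos (hv i _) (hv i _)).ne')
      hzF hzN hzX'

/-- A holonomic hypersurface whose associated pair satisfies the algebraic conditions admits, over
each simply connected open set, an isometric immersion into the flat space. -/
theorem exists_isometric_immersion (hs : s = 0 ∨ s = 1) (hs' : s' = 0 ∨ s' = 1) (hc : c ≠ 0)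
    (hf : IsHypersurface s c f) (hN : IsUnitNormal s c f N)
    (h : IsHolonomicWithPair s c f N u v V) (hpair : PairCondition s s' c 0 v V)
    {W : Set M} (hW : IsOpen W) (hsc : IsSimplyConnected W) :
    ∃ g : M → Fin 4 → ℝ, IsIsometricImmersionOn s s' c f g W := by
  have hu := h.coord
  have H := h.principalFrame hs hc hf hN
  set δ := deltaSign (indexSign s * indexSign s') (indexSign s' * (c - 0)) with hδ
  have hδ1 : ∀ i, δ i * δ i = 1 := deltaSign_mul_self _ _
  have hδ3 : δ 0 * δ 1 * δ 2 = -1 := deltaSign_prod _ _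
  have hsub := hu.image_subset_target W
  have hcp := fun i => contDiffOn_crossPair (δ := δ) H.smooth_v H.smooth_W i
  have hε := indexSign_mul_self hs
  have hε' := indexSign_mul_self hs'
  obtain ⟨G, hG, hGi⟩ := exists_flat_immersion (hu.isOpen_image hW) (hu.isSimplyConnected_image hsc)
    hs' (h := rot fun i => v i ∘ u.symm) (v := fun i => v i ∘ u.symm)
    (w := crossPair δ (fun i => v i ∘ u.symm) (fun i => V i ∘ u.symm))
    (fun i j => (H.smooth_rot i j).mono hsub) (fun i => (H.smooth_v i).mono hsub)
    (fun i => (hcp i).mono hsub) (fun i j _ x hx => H.pd_v (hsub hx) i j)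
    (fun i j hij x hx => pd_crossPair H.isOpen hδ1 H.smooth_v H.smooth_W H.v_ne
      (fun y _ => (hpair (u.symm y)).1) (fun y _ => (hpair (u.symm y)).2.1)
      (fun i j hij y hy => H.codazzi hy hij) (hsub hx) hij)
    (fun i j k hij hik hjk x hx => H.darboux (hsub hx) hij hik hjk)
    (fun i j k hij hik hjk x hx => by
      -- Since `ε̃² = 1`, one has `ε̃ C = c` and `ε̃ ε̂ = ε`, so `ε̃ w_i w_j` is the curvature term
      -- of the space form.
      have hp := hpair (u.symm x)
      rw [crossPair_mul_crossPair hδ1 hδ3 hp.1 hp.2.1 hp.2.2 hij]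
      linear_combination H.gauss (hsub hx) hij hik hjk
        + c * ((v i ∘ u.symm) x * (v j ∘ u.symm) x) * hε'
        + indexSign s * ((V i ∘ u.symm) x * (V j ∘ u.symm) x) * hε')
  have hGs : ContDiffOn ℝ ∞ (fun y a => G a y) (u '' W) := contDiffOn_pi.2 hG
  refine ⟨(fun y a => G a y) ∘ u, hu.contMDiffOn_comp hGs, fun x hx X Y => ?_⟩
  have hux : u x ∈ u '' W := ⟨x, hx, rfl⟩
  have hd : DifferentiableAt ℝ (fun y a => G a y) (u x) :=
    differentiableAt_of_contDiffOn (hu.isOpen_image hW) hGs hux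
  obtain ⟨a, ha⟩ := hu.eq_sum_coordField x X
  obtain ⟨b, hb⟩ := hu.eq_sum_coordField x Y
  have hg : ∀ j, dmap ((fun y a => G a y) ∘ u) x (coordField u j x)
      = fun a => pd j (G a) (u x) := fun j => by
    rw [hu.dmap_comp_coordField hd]
    funext k
    unfold pd
    rw [fderiv_pi fun a => differentiableAt_of_contDiffOn (hu.isOpen_image hW) (hG a) hux]
    rfl
  have hff : ∀ i j, ambientInner s c (dmap f x (coordField u i x)) (dmap f x (coordField u j x))
      = if i = j then v i x * v i x else 0 := fun i j => by
    split_ifs with hij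
    · rw [← hij]
      exact (h.norm_sq hf i _).2
    · exact h.orthogonal i j hij _
  have hbil : ∀ {n k : ℕ} (y z : Fin 3 → Fin n → ℝ), pseudoInner k (∑ i, a i • y i) (∑ j, b j • z j)
      = ∑ i, ∑ j, a i * b j * pseudoInner k (y i) (z j) := by
    intro n k y z
    simp only [pseudoInner, Finset.sum_apply, Pi.smul_apply, smul_eq_mul, Finset.sum_mul_sum]
    simp only [Finset.mul_sum]
    rw [Finset.sum_comm]
    refine Finset.sum_congr rfl fun i _ => ?_
    rw [Finset.sum_comm]
    exact Finset.sum_congr rfl fun j _ => Finset.sum_congr rfl fun l _ => by ring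
  rw [ha, hb]
  simp only [map_sum, map_smul]
  refine (hbil _ _).trans (Eq.trans ?_ (hbil (k := ambientIndex s c) _ _).symm)
  refine Finset.sum_congr rfl fun i _ => Finset.sum_congr rfl fun j _ => ?_
  rw [hg, hg, hGi i j _ hux]
  refine congrArg (a i * b j * ·) (Eq.trans ?_ (hff i j).symm)
  simp only [Function.comp, u.left_inv (hu.mem_source x)]

/-! ### The parallel map as a rotation in the plane of `f` and `N`. -/

section ParallelHypersurface

/-- The coefficients of the parallel map satisfy `φ² + ε c ψ² = 1`, and `φ > 0` when `ε c < 0`. -/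
theorem exists_parallelMap_eq {M : Type*} {s : ℕ} (hs : s = 0 ∨ s = 1) {c : ℝ} (hc : c ≠ 0)
    (f N : M → Fin 5 → ℝ) (t : ℝ) :
    ∃ φ ψ : ℝ, φ * φ + indexSign s * c * (ψ * ψ) = 1 ∧ (indexSign s * c < 0 → 0 < φ) ∧
      parallelMap s c f N t = fun x => φ • f x + ψ • N x := by
  have hε := indexSign_mul_self hs
  have habs : |indexSign s| = 1 := by
    rcases hs with rfl | rfl <;> norm_num [indexSign]
  have hcabs : |indexSign s * c| = |c| := by rw [abs_mul, habs, one_mul]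
  have hcp : 0 < |c| := abs_pos.2 hc
  have hsq : √|c| * √|c| = |c| := Real.mul_self_sqrt hcp.le
  have hsq0 : √|c| ≠ 0 := (Real.sqrt_pos.2 hcp).ne'
  have hdiv : ∀ a : ℝ, |c| * (a / √|c| * (a / √|c|)) = a * a := fun a => by
    rw [div_mul_div_comm, hsq]
    field_simp
  by_cases h : 0 < indexSign s * c
  · refine ⟨Real.cos (√|c| * t), Real.sin (√|c| * t) / √|c|, ?_, fun h' => absurd h (not_lt.2 h'.le),
      ?_⟩
    · rw [← abs_of_pos h, hcabs, hdiv]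
      linear_combination Real.cos_sq_add_sin_sq (√|c| * t)
    · funext x
      rw [parallelMap, if_pos h]
  · refine ⟨Real.cosh (√|c| * t), Real.sinh (√|c| * t) / √|c|, ?_, fun _ => Real.cosh_pos _, ?_⟩
    · have h1 : indexSign s * c = -|c| := by
        rw [← hcabs, abs_of_nonpos (not_lt.1 h), neg_neg]
      rw [h1, neg_mul, hdiv]
      linear_combination Real.cosh_sq_sub_sinh_sq (√|c| * t)
    · funext x
      rw [parallelMap, if_neg h]

/-- A geodesic of hyperbolic space does not leave the sheet in which it starts. -/
theorem combination_pos_of_sheet {c : ℝ} (hc : c < 0) {p n : Fin 5 → ℝ}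
    (hpp : ambientInner 0 c p p = 1 / c) (hnn : ambientInner 0 c n n = 1)
    (hnp : ambientInner 0 c n p = 0) (hp : 0 < p 0) {φ ψ : ℝ} (hφψ : φ * φ + c * (ψ * ψ) = 1)
    (hφ : 0 < φ) : 0 < φ * p 0 + ψ * n 0 := by
  simp only [ambientInner, pseudoInner, ambientIndex, if_pos hc, Fin.sum_univ_succ (n := 4)] at *
  simp only [Fin.val_zero, Fin.val_succ, zero_add, Nat.lt_one_iff, Nat.add_eq_zero_iff, one_ne_zero,
    and_false, if_false, if_true, one_mul] at hpp hnn hnp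
  -- Cauchy-Schwarz on the space-like parts of `n` and `p` yields `1 + n₀² + c p₀² ≤ 0`. With `φ² =
  -- 1 - c ψ²` this gives `|ψ n₀| < φ p₀`.
  have hcs := Finset.sum_mul_sq_le_sq_mul_sq Finset.univ (fun i : Fin 4 => n i.succ)
    (fun i : Fin 4 => p i.succ)
  simp only [pow_two] at hcs
  have e1 : ∑ i : Fin 4, p i.succ * p i.succ = 1 / c + p 0 * p 0 := by linarith
  have e2 : ∑ i : Fin 4, n i.succ * n i.succ = 1 + n 0 * n 0 := by linarith
  have e3 : ∑ i : Fin 4, n i.succ * p i.succ = n 0 * p 0 := by linarith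
  rw [e1, e2, e3] at hcs
  have hk : 1 + n 0 * n 0 + c * (p 0 * p 0) ≤ 0 := by
    have hc' := hc.ne
    have h1 : 0 ≤ (1 + n 0 * n 0) * (1 / c) + p 0 * p 0 := by linarith
    have h2 := mul_nonpos_of_nonpos_of_nonneg hc.le h1
    have h3 : c * ((1 + n 0 * n 0) * (1 / c) + p 0 * p 0) = 1 + n 0 * n 0 + c * (p 0 * p 0) := by
      field_simp
    linarith
  have hlt : |ψ * n 0| < |φ * p 0| := by
    rw [← sq_lt_sq]
    have h1 : 0 < p 0 * p 0 := mul_pos hp hp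
    have h2 := mul_nonneg (mul_self_nonneg ψ) (neg_nonneg.2 hk)
    have h3 := mul_self_nonneg ψ
    have h4 : φ * φ = 1 - c * (ψ * ψ) := by linarith
    calc (ψ * n 0) ^ 2 = ψ * ψ * (n 0 * n 0) := by ring
      _ < (1 - c * (ψ * ψ)) * (p 0 * p 0) := by linarith
      _ = (φ * p 0) ^ 2 := by rw [← h4]; ring
  rw [abs_of_pos (mul_pos hφ hp)] at hlt
  linarith [neg_abs_le (ψ * n 0)]

variable {M : Type*} [TopologicalSpace M] [ChartedSpace (EuclideanSpace ℝ (Fin 3)) M]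
  {u : OpenPartialHomeomorph M (EuclideanSpace ℝ (Fin 3))} {s s' : ℕ} {c : ℝ}
  {f N : M → Fin 5 → ℝ} {v V : Fin 3 → M → ℝ}

theorem contMDiff_combination {n : ℕ} {f N : M → Fin n → ℝ}
    (hf : ContMDiff (𝓡 3) 𝓘(ℝ, Fin n → ℝ) ∞ f) (hN : ContMDiff (𝓡 3) 𝓘(ℝ, Fin n → ℝ) ∞ N)
    (a b : ℝ) : ContMDiff (𝓡 3) 𝓘(ℝ, Fin n → ℝ) ∞ fun x => a • f x + b • N x := by
  have h : ContDiff ℝ ∞ fun p : (Fin n → ℝ) × (Fin n → ℝ) => a • p.1 + b • p.2 := by fun_prop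
  exact h.contMDiff.comp (hf.prodMk_space hN)

theorem dmap_combination {n : ℕ} {f N : M → Fin n → ℝ}
    (hf : ContMDiff (𝓡 3) 𝓘(ℝ, Fin n → ℝ) ∞ f) (hN : ContMDiff (𝓡 3) 𝓘(ℝ, Fin n → ℝ) ∞ N)
    (a b : ℝ) (x : M) (X : TangentSpace (𝓡 3) x) :
    dmap (fun x => a • f x + b • N x) x X = a • dmap f x X + b • dmap N x X := by
  have h1 := (hf.mdifferentiable (by simp) x).hasMFDerivAt
  have h2 := (hN.mdifferentiable (by simp) x).hasMFDerivAt
  have h3 := ((h1.const_smul a).add (h2.const_smul b)).mfderiv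
  exact DFunLike.congr_fun h3 X

theorem IsHolonomicWithPair.inner_dmap_position (hf : IsHypersurface s c f)
    (h : IsHolonomicWithPair s c f N u v V) (x : M) (X : TangentSpace (𝓡 3) x) :
    ambientForm s c (f x) (dmap f x X) = 0 := by
  have hu := h.coord
  have hF := hu.contDiffOn_comp_symm hf.smooth
  have hy : u x ∈ u.target := u.map_source (hu.mem_source x)
  have hd := differentiableAt_of_contDiffOn u.open_target hF hy
  have h0 : ∀ z ∈ u.target, ambientForm s c ((f ∘ u.symm) z) ((f ∘ u.symm) z) = 1 / c :=
    fun z _ => (ambientForm_apply s c _ _).trans (hf.mem_spaceForm (u.symm z)).1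
  have hj : ∀ j, ambientForm s c (f x) (dmap f x (coordField u j x)) = 0 := fun j => by
    have h1 := pd_bilin (ambientForm s c) hd hd j
    rw [pd_eq_zero_of_const u.open_target h0 hy, hu.pd_comp_symm hf.smooth, Function.comp_apply,
      u.left_inv (hu.mem_source x), ambientForm_symm s c (dmap f x (coordField u j x))] at h1
    linarith
  obtain ⟨a, ha⟩ := hu.eq_sum_coordField x X
  rw [ha]
  simp only [map_sum, map_smul, hj, smul_zero, Finset.sum_const_zero]

/-- The endomorphism with prescribed eigenvalues on the coordinate fields. -/
theorem IsGlobalCoord.exists_diagonal (hu : IsGlobalCoord u) (r : Fin 3 → M → ℝ) :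
    ∃ A : ∀ x : M, TangentSpace (𝓡 3) x →ₗ[ℝ] TangentSpace (𝓡 3) x,
      ∀ j x, A x (coordField u j x) = r j x • coordField u j x := by
  let κ : ∀ x : M, Fin 3 → TangentSpace (𝓡 3) x →ₗ[ℝ] ℝ := fun x j =>
    ((EuclideanSpace.proj j : E3 →L[ℝ] ℝ).comp
      (show TangentSpace (𝓡 3) x →L[ℝ] E3 from mfderiv (𝓡 3) (𝓡 3) u x)).toLinearMap
  have hκ : ∀ x i j, κ x i (coordField u j x) = if i = j then 1 else 0 := fun x i j => by
    have h1 : κ x i (coordField u j x)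
        = (EuclideanSpace.proj i : E3 →L[ℝ] ℝ) (mfderiv (𝓡 3) (𝓡 3) u x (coordField u j x)) := rfl
    rw [h1, hu.mfderiv_coordField]
    simp
  refine ⟨fun x => ∑ i, (r i x • κ x i).smulRight (coordField u i x), fun j x => ?_⟩
  simp [hκ]

end ParallelHypersurface

/-! ### The hypersurface, unit normal and associated pair of the parallel map. -/

section ParallelPair

variable {M : Type*} [TopologicalSpace M] [ChartedSpace (EuclideanSpace ℝ (Fin 3)) M]
  {u : OpenPartialHomeomorph M (EuclideanSpace ℝ (Fin 3))} {s : ℕ} {c : ℝ}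
  {f N : M → Fin 5 → ℝ} {v V : Fin 3 → M → ℝ} {φ ψ : ℝ}

/-- The differential factors as `df ∘ (φ - ψ A)`, so its image lies in that of `df`, and injectivity
alone makes the new metric Riemannian. -/
theorem isHypersurface_combination (hs : s = 0 ∨ s = 1) (hc : c ≠ 0)
    (hf : IsHypersurface s c f) (hN : IsUnitNormal s c f N)
    (h : IsHolonomicWithPair s c f N u v V) (hφψ : φ * φ + indexSign s * c * (ψ * ψ) = 1)
    (hφ : indexSign s * c < 0 → 0 < φ)
    (hinj : ∀ x, Function.Injective (dmap (fun x => φ • f x + ψ • N x) x)) :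
    IsHypersurface s c fun x => φ • f x + ψ • N x := by
  have hε := indexSign_mul_self hs
  refine ⟨contMDiff_combination hf.smooth hN.smooth φ ψ, fun x => ⟨?_, ?_⟩, fun x X hX => ?_⟩
  · have h1 := (hf.mem_spaceForm x).1
    have h2 := hN.tangent x
    have h3 := hN.unit x
    rw [← ambientForm_apply] at *
    have h4 := (ambientForm_symm s c (f x) (N x)).trans h2
    simp only [map_add, map_smul, add_apply, smul_apply, smul_eq_mul, h1, h2, h3, h4]
    field_simp
    linear_combination hφψ
  · rintro rfl hc0
    have hp := hf.mem_spaceForm x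
    have hu := hN.unit x
    simp only [indexSign, Nat.cast_zero, mul_zero, sub_zero, one_mul] at hφψ hφ hu
    exact combination_pos_of_sheet hc0 hp.1 hu (hN.tangent x) (hp.2 rfl hc0) hφψ (hφ hc0)
  · obtain ⟨A, hA, -⟩ := h.principal
    have e : dmap (fun x => φ • f x + ψ • N x) x X = dmap f x (φ • X - ψ • A x X) := by
      rw [dmap_combination hf.smooth hN.smooth, map_sub, map_smul, map_smul, hA x X]
      module
    rw [e]
    refine hf.spacelike x _ fun h0 => hX (hinj x ?_)
    rw [e, h0, map_zero, map_zero]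

/-- The new normal is the companion of `φ f + ψ N` in the plane of `f` and `N`; the coefficient `-ε
c ψ` compensates for `⟨f, f⟩ = 1/c` and `⟨N, N⟩ = ε`. -/
theorem isUnitNormal_combination (hs : s = 0 ∨ s = 1) (hc : c ≠ 0)
    (hf : IsHypersurface s c f) (hN : IsUnitNormal s c f N)
    (h : IsHolonomicWithPair s c f N u v V) (hφψ : φ * φ + indexSign s * c * (ψ * ψ) = 1) :
    IsUnitNormal s c (fun x => φ • f x + ψ • N x)
      fun x => (-(indexSign s * c * ψ)) • f x + φ • N x := by
  have hε := indexSign_mul_self hs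
  have h1 := fun x => (ambientForm_apply s c _ _).trans (hf.mem_spaceForm x).1
  have h2 := fun x => (ambientForm_apply s c _ _).trans (hN.tangent x)
  have h3 := fun x => (ambientForm_apply s c _ _).trans (hN.unit x)
  have h4 := fun x => (ambientForm_symm s c (f x) (N x)).trans (h2 x)
  refine ⟨contMDiff_combination hf.smooth hN.smooth _ φ, fun x => ?_, fun x X => ?_, fun x => ?_⟩
  · rw [← ambientForm_apply]
    simp only [map_add, map_smul, add_apply, smul_apply, smul_eq_mul, h1, h2, h3, h4]
    field_simp
    ring
  · obtain ⟨A, hA, -⟩ := h.principal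
    have e : dmap (fun x => φ • f x + ψ • N x) x X = dmap f x (φ • X - ψ • A x X) := by
      rw [dmap_combination hf.smooth hN.smooth, map_sub, map_smul, map_smul, hA x X]
      module
    have h5 := (ambientForm_apply s c _ _).trans (hN.normal x (φ • X - ψ • A x X))
    rw [← ambientForm_apply, e]
    simp only [map_add, map_smul, add_apply, smul_apply, smul_eq_mul, h5,
      h.inner_dmap_position hf x]
    ring
  · rw [← ambientForm_apply]
    simp only [map_add, map_smul, add_apply, smul_apply, smul_eq_mul, h1, h2, h3, h4]
    have hcc : indexSign s * c * ψ * (indexSign s * c * ψ * (1 / c)) = c * (ψ * ψ) := by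
      field_simp
      linear_combination ψ ^ 2 * hε
    linear_combination hcc + indexSign s * hφψ - c * (ψ * ψ) * hε

theorem IsHolonomicWithPair.dmap_combination_coordField (h : IsHolonomicWithPair s c f N u v V)
    (hf : IsHypersurface s c f) (hN : IsUnitNormal s c f N) (φ ψ : ℝ) (j : Fin 3) (x : M) :
    dmap (fun x => φ • f x + ψ • N x) x (coordField u j x)
      = ((φ * v j x - ψ * V j x) / v j x) • dmap f x (coordField u j x) := by
  rw [dmap_combination hf.smooth hN.smooth, h.dmap_normal, smul_neg, smul_smul, ← sub_eq_add_neg,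
    ← sub_smul]
  congr 1
  have := (h.norm_sq hf j x).1.ne'
  field_simp

theorem IsHolonomicWithPair.sub_ne_zero_of_injective (h : IsHolonomicWithPair s c f N u v V)
    (hf : IsHypersurface s c f) (hN : IsUnitNormal s c f N)
    (hinj : ∀ x, Function.Injective (dmap (fun x => φ • f x + ψ • N x) x)) (j : Fin 3) (x : M) :
    φ * v j x - ψ * V j x ≠ 0 := fun h0 => by
  refine h.coord.coordField_ne_zero j x (hinj x ?_)
  rw [h.dmap_combination_coordField hf hN, h0, zero_div, zero_smul, map_zero]

theorem abs_inv_mul_sign (r : ℝ) : |r|⁻¹ * (SignType.sign r : ℝ) = r⁻¹ := by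
  rcases lt_trichotomy r 0 with h0 | rfl | h0
  · rw [abs_of_neg h0, sign_neg h0, inv_neg]
    simp
  · simp
  · rw [abs_of_pos h0, sign_pos h0]
    simp

theorem sign_mul_self_of_ne_zero {r : ℝ} (hr : r ≠ 0) :
    (SignType.sign r : ℝ) * (SignType.sign r : ℝ) = 1 := by
  rcases lt_or_gt_of_ne hr with h0 | h0
  · simp [sign_neg h0]
  · simp [sign_pos h0]

/-- The associated pair of a parallel hypersurface. -/
theorem isHolonomicWithPair_combination (hf : IsHypersurface s c f) (hN : IsUnitNormal s c f N)
    (h : IsHolonomicWithPair s c f N u v V)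
    (hinj : ∀ x, Function.Injective (dmap (fun x => φ • f x + ψ • N x) x)) :
    IsHolonomicWithPair s c (fun x => φ • f x + ψ • N x)
      (fun x => (-(indexSign s * c * ψ)) • f x + φ • N x) u
      (fun j x => |φ * v j x - ψ * V j x|)
      (fun j x => (SignType.sign (φ * v j x - ψ * V j x) : ℝ) *
        (φ * V j x + indexSign s * c * ψ * v j x)) := by
  have hu := h.coord
  have hv := fun j x => (h.norm_sq hf j x).1
  have hdf := h.dmap_combination_coordField hf hN φ ψ
  have hdN : ∀ j x, dmap (fun x => (-(indexSign s * c * ψ)) • f x + φ • N x) x (coordField u j x)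
      = -(((φ * V j x + indexSign s * c * ψ * v j x) / v j x) • dmap f x (coordField u j x)) :=
    fun j x => by
      rw [dmap_combination hf.smooth hN.smooth, h.dmap_normal, smul_neg, smul_smul, neg_smul,
        ← neg_add, ← add_smul]
      congr 2
      have := (hv j x).ne'
      field_simp
      ring
  refine ⟨hu, fun i j hij x => ?_, fun j x => ?_, ?_⟩
  · rw [hdf, hdf, ← ambientForm_apply]
    simp only [map_smul, smul_apply]
    rw [ambientForm_apply, h.orthogonal i j hij, smul_zero, smul_zero]
  · rw [hdf, ← ambientForm_apply]
    simp only [map_smul, smul_apply, smul_eq_mul]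
    rw [ambientForm_apply, (h.norm_sq hf j x).2, ← Real.sqrt_mul_self_eq_abs]
    congr 1
    have := (hv j x).ne'
    field_simp
  · obtain ⟨A, hA⟩ := hu.exists_diagonal fun j x =>
      |φ * v j x - ψ * V j x|⁻¹ * ((SignType.sign (φ * v j x - ψ * V j x) : ℝ) *
        (φ * V j x + indexSign s * c * ψ * v j x))
    refine ⟨A, fun x X => ?_, hA⟩
    obtain ⟨a, ha⟩ := hu.eq_sum_coordField x X
    rw [ha]
    simp only [map_sum, map_smul]
    rw [← Finset.sum_neg_distrib]
    refine Finset.sum_congr rfl fun j _ => ?_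
    rw [← smul_neg]
    refine congrArg (a j • ·) ?_
    rw [hA, map_smul, hdf, hdN, neg_neg, smul_smul]
    refine congrArg (fun r : ℝ => r • dmap f x (coordField u j x)) ?_
    have h2 := h.sub_ne_zero_of_injective hf hN hinj j x
    have h3 := (hv j x).ne'
    -- The norm must be positive, so the sign of `φ v_j - ψ V_j` is moved into `V'_j`. The
    -- eigenvalue is then `(φ V_j + ε c ψ v_j) / (φ v_j - ψ V_j)` for either sign.
    rw [← mul_assoc, abs_inv_mul_sign]
    field_simp

end ParallelPair

/-- The signs drop out because the three sums are quadratic in each `(v_j, V_j)`. By hypothesis the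
Gram matrix of `v`, `V` is `ε̂ diag(1, ε c)`, as `C = ε c ε̂`, and the substitution `(φ, -ψ; ε c ψ,
φ)` preserves it because `φ² + ε c ψ² = 1`. -/
theorem pairCondition_combination {M : Type*} {s s' : ℕ} {c φ ψ : ℝ} {v V : Fin 3 → M → ℝ}
    (hs : s = 0 ∨ s = 1)
    (hinj : ∀ j x, φ * v j x - ψ * V j x ≠ 0)
    (hφψ : φ * φ + indexSign s * c * (ψ * ψ) = 1) (hpair : PairCondition s s' c 0 v V) :
    PairCondition s s' c 0 (fun j x => |φ * v j x - ψ * V j x|)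
      (fun j x => (SignType.sign (φ * v j x - ψ * V j x) : ℝ) *
        (φ * V j x + indexSign s * c * ψ * v j x)) := by
  have hε := indexSign_mul_self hs
  simp only [PairCondition]
  generalize hδ : deltaSign (indexSign s * indexSign s') (indexSign s' * (c - 0)) = δ
  intro x
  obtain ⟨h1, h2, h3⟩ := hpair x
  simp only [hδ, Fin.sum_univ_three] at h1 h2 h3
  have hmul : ∀ (j : Fin 3) (r : ℝ), |φ * v j x - ψ * V j x| *
      ((SignType.sign (φ * v j x - ψ * V j x) : ℝ) * r) = (φ * v j x - ψ * V j x) * r :=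
    fun j r => by rw [← mul_assoc, abs_mul_sign]
  have hsq : ∀ (j : Fin 3) (r : ℝ),
      ((SignType.sign (φ * v j x - ψ * V j x) : ℝ) * r) ^ 2 = r ^ 2 := fun j r => by
    rw [mul_pow, pow_two (SignType.cast _), sign_mul_self_of_ne_zero (hinj j x), one_mul]
  simp only [sq_abs, hmul, hsq, Fin.sum_univ_three]
  refine ⟨?_, ?_, ?_⟩
  · linear_combination φ ^ 2 * h1 - 2 * φ * ψ * h2 + ψ ^ 2 * h3
      + indexSign s * indexSign s' * hφψ - indexSign s' * c * ψ ^ 2 * hε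
  · linear_combination φ * (indexSign s * c * ψ) * h1
      + (φ ^ 2 - indexSign s * c * ψ ^ 2) * h2 - φ * ψ * h3 + indexSign s' * c * φ * ψ * hε
  · linear_combination φ ^ 2 * h3 + 2 * φ * (indexSign s * c * ψ) * h2
      + (indexSign s * c * ψ) ^ 2 * h1 + indexSign s' * c * hφψ
      + indexSign s * indexSign s' * c ^ 2 * ψ ^ 2 * hε

end HolonomicHypersurface

end

theorem corollary8 {M : Type*} [TopologicalSpace M]
    [ChartedSpace (EuclideanSpace ℝ (Fin 3)) M] [IsManifold (𝓡 3) ∞ M]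
    (s s' : ℕ) (hs : s = 0 ∨ s = 1) (hs' : s' = 0 ∨ s' = 1) (c : ℝ) (hc : c ≠ 0)
    (f N : M → (Fin 5 → ℝ))
    (hf : HolonomicHypersurface.IsHypersurface s c f)
    (hN : HolonomicHypersurface.IsUnitNormal s c f N)
    (u : OpenPartialHomeomorph M (EuclideanSpace ℝ (Fin 3))) (v V : Fin 3 → M → ℝ)
    (hhol : HolonomicHypersurface.IsHolonomicWithPair s c f N u v V)
    (hpair : HolonomicHypersurface.PairCondition s s' c 0 v V)
    (t : ℝ)
    (ht : ∀ x : M, Function.Injective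
      (HolonomicHypersurface.dmap (HolonomicHypersurface.parallelMap s c f N t) x)) :
    HolonomicHypersurface.IsHypersurface s c (HolonomicHypersurface.parallelMap s c f N t) ∧
    (∃ (N' : M → (Fin 5 → ℝ)) (v' V' : Fin 3 → M → ℝ),
      HolonomicHypersurface.IsUnitNormal s c
        (HolonomicHypersurface.parallelMap s c f N t) N' ∧
      HolonomicHypersurface.IsHolonomicWithPair s c
        (HolonomicHypersurface.parallelMap s c f N t) N' u v' V' ∧
      HolonomicHypersurface.PairCondition s s' c 0 v' V') ∧
    (∀ W : Set M, IsOpen W → IsSimplyConnected W →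
      ∃ g : M → (Fin 4 → ℝ), HolonomicHypersurface.IsIsometricImmersionOn s s' c
        (HolonomicHypersurface.parallelMap s c f N t) g W) := by
  obtain ⟨φ, ψ, hφψ, hφ, heq⟩ := HolonomicHypersurface.exists_parallelMap_eq hs hc f N t
  rw [heq] at ht ⊢
  have hyp := HolonomicHypersurface.isHypersurface_combination hs hc hf hN hhol hφψ hφ ht
  have normal := HolonomicHypersurface.isUnitNormal_combination hs hc hf hN hhol hφψ
  have holo := HolonomicHypersurface.isHolonomicWithPair_combination hf hN hhol ht
  have pair := HolonomicHypersurface.pairCondition_combination hs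
    (hhol.sub_ne_zero_of_injective hf hN ht) hφψ hpair
  exact ⟨hyp, ⟨_, _, _, normal, holo, pair⟩, fun W hW hsc =>
    HolonomicHypersurface.exists_isometric_immersion hs hs' hc hyp normal holo pair hW hsc⟩
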